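/- Let $\mathbf{Top}$ be a convenient category of spaces; all that is used is that it is a cartesian closed full subcategory of the category of topological spaces which contains the unit interval $I=[0,1]$. Let $\mathcal C$ be a complete, cocomplete and locally small category that is enriched, tensored and cotensored over $\mathbf{Top}$. Write $i_0\colon A\to A\otimes I$ and $p_0\colon Y^I\to Y$ for the maps induced by the endpoint $0\in I$, and $\mathcal C^{\mathbf 2}$ for the category of arrows of $\mathcal C$. For an arrow $f\colon X\to Y$ let $Nf$ be the pullback of $f$ along $p_0\colon Y^I\to Y$, with projections $\phi_f\colon Nf\to X$ and $\chi_f\colon Nf\to Y^I$; let $Ef$ be the pushout of $\phi_f$ along $i_0\colon Nf\to Nf\otimes I$, with coprojection $Lf\colon X\to Ef$; and let $Rf\colon Ef\to Y$ be induced by $f$ and the adjunct $Nf\otimes I\to Y$ of $\chi_f$. Then $N$ and $E$ are functors $\mathcal C^{\mathbf 2}\to\mathcal C$, and $R$ is an endofunctor of $\mathcal C^{\mathbf 2}$ that preserves codomains, pointed by the squares $\eta_f=(Lf,\mathrm{id}_Y)\colon f\to Rf$. For a class $\mathcal M$ of arrows of $\mathcal C$ and a regular cardinal $\alpha$, say that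 a functor $F$ on $\mathcal C^{\mathbf 2}$ *preserves $\alpha$-indexed $\mathcal M$-colimits over a fixed codomain* if, for every $\alpha$-indexed sequence $(f_\beta\colon X_\beta\to Y)_{\beta<\alpha}$ of arrows over a fixed object $Y$ and every cocone $f_\alpha\colon X_\alpha\to Y$ over $Y$ such that $X_\alpha=\operatorname{colim}_{\beta<\alpha}X_\beta$ in $\mathcal C$ with all legs $X_\beta\to X_\alpha$ in $\mathcal M$, the induced cocone exhibits $F f_\alpha$ as $\operatorname{colim}_{\beta<\alpha}F f_\beta$. Let $(\mathcal E,\mathcal M)$ be an orthogonal factorization system on $\mathcal C$ that is well-copowered (each object has, up to isomorphism, only a set of $\mathcal E$-quotients), and assume the *monomorphism hypothesis*: there is a regular cardinal $\alpha$ for which $N$ preserves $\alpha$-indexed $\mathcal M$-colimits over a fixed codomain. Then: 1. For every regular cardinal $\alpha$ for which $N$ preserves $\alpha$-indexed $\mathcal M$-colimits over a fixed codomain, the functors $E$ and $R$ preserve them too. 2. Consequently $R$ satisfies the smallness condition $(\dagger)$ (in its form for endofunctors of $\mathcal C^{\mathbf 2}$ that preserve codomains): there are a well-copowered orthogonal factorization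 system $(\mathcal E',\mathcal M')$ on $\mathcal C$ and a regular cardinal $\alpha$ such that $R$ preserves $\alpha$-indexed $\mathcal M'$-colimits over a fixed codomain. 3. The free monad on the pointed endofunctor $(R,\eta)$ exists constructively. That is, there is a monad $\mathbb F$ on $\mathcal C^{\mathbf 2}$ together with an isomorphism of categories $\mathbf{Alg}_{\mathbb F}\cong\mathbf{Alg}_{R}$ over $\mathcal C^{\mathbf 2}$, where $\mathbf{Alg}_R$ is the category of arrows $g$ with a map $s\colon Rg\to g$ such that $s\,\eta_g=\mathrm{id}$; and for every arrow $f$ the following transfinite sequence of objects $X_\beta$ of $\mathcal C^{\mathbf 2}$ with maps $x_\beta\colon RX_\beta\to X_{\beta+1}$ exists and converges, i.e. for some ordinal $\beta$ all the maps $X_\beta\to X_\gamma$ with $\gamma\ge\beta$ are isomorphisms. One has $X_0=f$, $X_1=Rf$ and $x_0=\mathrm{id}$; the map $X_\beta\to X_{\beta+1}$ is $x_\beta\,\eta_{X_\beta}$; the map $x_{\beta+1}$ is the coequalizer of $\eta_{X_{\beta+1}}x_\beta$ and $R(X_\beta\to X_{\beta+1})$, both $RX_\beta\to RX_{\beta+1}$;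 for a limit ordinal $\lambda$, $X_\lambda=\operatorname{colim}_{\beta<\lambda}X_\beta$, and $x_\lambda$ is the coequalizer of the canonical map $\operatorname{colim}_{\beta<\lambda}RX_\beta\to RX_\lambda$ and the composite of $\operatorname{colim}_{\beta<\lambda}x_\beta\colon\operatorname{colim}_{\beta<\lambda}RX_\beta\to X_\lambda$ with $\eta_{X_\lambda}$. Moreover, for such an ordinal $\beta$ there is an isomorphism $X_\beta\cong\mathbb Ff$ in such a way that the unit $f\to\mathbb Ff$ is $X_0\to X_\beta$ and the $R$-algebra structure on the free algebra $\mathbb Ff$ is $x_\beta$ followed by the inverse of $X_\beta\to X_{\beta+1}$. -/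

import Mathlib

open CategoryTheory Limits MonoidalCategory CartesianMonoidalCategory

universe w v u v' u'

noncomputable section

namespace Hurewicz

/-! ## Tensors and cotensors in an enriched category -/

section Tensors

variable (V : Type u') [Category.{v'} V] [CartesianMonoidalCategory V]
variable (C : Type u) [Category.{v} C] [EnrichedOrdinaryCategory V C]

variable {C} in
lemma eHomEquiv_comp_left {X Y Z : C} (f : X ⟶ Y) (g : Y ⟶ Z) :
    eHomEquiv V (f ≫ g) = eHomEquiv V f ≫ eHomWhiskerLeft V X g := by
  rw [eHomEquiv_comp, eHomWhiskerLeft, MonoidalCategory.tensorHom_def, rightUnitor_inv_naturality_assoc,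
    Category.assoc, unitors_inv_equal]

variable {C} in
lemma eHomEquiv_comp_right {X Y Z : C} (f : X ⟶ Y) (g : Y ⟶ Z) :
    eHomEquiv V (f ≫ g) = eHomEquiv V g ≫ eHomWhiskerRight V f Z := by
  rw [eHomEquiv_comp, eHomWhiskerRight, MonoidalCategory.tensorHom_def', leftUnitor_inv_naturality_assoc,
    Category.assoc]

variable [MonoidalClosed V]

/-- A `V`-category is tensored: for all `X : C` and `K : V` there is an object `X ⊗ K`
with a universal map `K ⟶ C(X, X ⊗ K)`, i.e. one inducing isomorphisms
`C(X ⊗ K, Y) ≅ V(K, C(X, Y))` of objects of `V`. -/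
class Tensored where
  /-- the object `X ⊗ K` -/
  obj : C → V → C
  /-- the universal map `K ⟶ C(X, X ⊗ K)` -/
  unit (X : C) (K : V) : K ⟶ (X ⟶[V] obj X K)
  isIso_curry (X : C) (K : V) (Y : C) :
    IsIso (MonoidalClosed.curry (unit X K ▷ (obj X K ⟶[V] Y) ≫ eComp V X (obj X K) Y))

/-- A `V`-category is cotensored: for all `K : V` and `Y : C` there is an object `Y ^ K`
with a universal map `K ⟶ C(Y ^ K, Y)`, i.e. one inducing isomorphisms
`C(X, Y ^ K) ≅ V(K, C(X, Y))` of objects of `V`. -/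
class Cotensored where
  /-- the object `Y ^ K` -/
  obj : V → C → C
  /-- the universal map `K ⟶ C(Y ^ K, Y)` -/
  counit (K : V) (Y : C) : K ⟶ (obj K Y ⟶[V] Y)
  isIso_curry (K : V) (X Y : C) :
    IsIso (MonoidalClosed.curry
      (lift (snd K (X ⟶[V] obj K Y)) (fst K (X ⟶[V] obj K Y) ≫ counit K Y) ≫
        eComp V X (obj K Y) Y))

variable {V C}

/-- Morphisms `X ⊗ K ⟶ Y` in `C` correspond to morphisms `K ⟶ C(X, Y)` in `V`. -/
def tensorEquiv [Tensored V C] (X : C) (K : V) (Y : C) :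
    (Tensored.obj X K ⟶ Y) ≃ (K ⟶ (X ⟶[V] Y)) :=
  haveI := Tensored.isIso_curry (V := V) X K Y
  (eHomEquiv V).trans <|
    (asIso (MonoidalClosed.curry (Tensored.unit X K ▷ (Tensored.obj X K ⟶[V] Y) ≫
      eComp V X (Tensored.obj X K) Y))).homToEquiv.trans <|
    ((ihom.adjunction K).homEquiv (𝟙_ V) (X ⟶[V] Y)).symm.trans (ρ_ K).homFromEquiv

lemma tensorEquiv_apply [Tensored V C] {X : C} {K : V} {Y : C} (g : Tensored.obj X K ⟶ Y) :
    tensorEquiv X K Y g = Tensored.unit X K ≫ eHomWhiskerLeft V X g := by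
  change (ρ_ K).inv ≫ MonoidalClosed.uncurry (eHomEquiv V g ≫ MonoidalClosed.curry _) = _
  rw [MonoidalClosed.uncurry_natural_left, MonoidalClosed.uncurry_curry,
    whisker_exchange_assoc, eHomWhiskerLeft, rightUnitor_inv_naturality_assoc]

/-- Morphisms `X ⟶ Y ^ K` in `C` correspond to morphisms `K ⟶ C(X, Y)` in `V`. -/
def cotensorEquiv [Cotensored V C] (K : V) (X Y : C) :
    (X ⟶ Cotensored.obj K Y) ≃ (K ⟶ (X ⟶[V] Y)) :=
  haveI := Cotensored.isIso_curry (V := V) K X Y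
  (eHomEquiv V).trans <|
    (asIso (MonoidalClosed.curry
      (lift (snd K (X ⟶[V] Cotensored.obj K Y))
        (fst K (X ⟶[V] Cotensored.obj K Y) ≫ Cotensored.counit K Y) ≫
        eComp V X (Cotensored.obj K Y) Y))).homToEquiv.trans <|
    ((ihom.adjunction K).homEquiv (𝟙_ V) (X ⟶[V] Y)).symm.trans (ρ_ K).homFromEquiv

lemma cotensorEquiv_apply [Cotensored V C] {K : V} {X Y : C} (g : X ⟶ Cotensored.obj K Y) :
    cotensorEquiv K X Y g = Cotensored.counit K Y ≫ eHomWhiskerRight V g Y := by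
  change (ρ_ K).inv ≫ MonoidalClosed.uncurry (eHomEquiv V g ≫ MonoidalClosed.curry _) = _
  rw [MonoidalClosed.uncurry_natural_left, MonoidalClosed.uncurry_curry, eHomWhiskerRight]
  simp only [← Category.assoc]
  congr 1
  apply CartesianMonoidalCategory.hom_ext <;> simp

/-- The map `f ⊗ K : X ⊗ K ⟶ X' ⊗ K` induced by `f : X ⟶ X'`. -/
def tensorMap [Tensored V C] (K : V) {X X' : C} (f : X ⟶ X') :
    Tensored.obj X K ⟶ Tensored.obj X' K :=
  (tensorEquiv X K _).symm (Tensored.unit X' K ≫ eHomWhiskerRight V f (Tensored.obj X' K))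

/-- The map `g ^ K : Y ^ K ⟶ Y' ^ K` induced by `g : Y ⟶ Y'`. -/
def cotensorMap [Cotensored V C] (K : V) {Y Y' : C} (g : Y ⟶ Y') :
    Cotensored.obj K Y ⟶ Cotensored.obj K Y' :=
  (cotensorEquiv K _ Y').symm (Cotensored.counit K Y ≫ eHomWhiskerLeft V (Cotensored.obj K Y) g)

lemma unit_tensorMap [Tensored V C] (K : V) {X X' : C} (f : X ⟶ X') :
    Tensored.unit X K ≫ eHomWhiskerLeft V X (tensorMap K f) =
      Tensored.unit X' K ≫ eHomWhiskerRight V f (Tensored.obj X' K) := by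
  rw [← tensorEquiv_apply, tensorMap, Equiv.apply_symm_apply]

lemma counit_cotensorMap [Cotensored V C] (K : V) {Y Y' : C} (g : Y ⟶ Y') :
    Cotensored.counit K Y' ≫ eHomWhiskerRight V (cotensorMap K g) Y' =
      Cotensored.counit K Y ≫ eHomWhiskerLeft V (Cotensored.obj K Y) g := by
  rw [← cotensorEquiv_apply, cotensorMap, Equiv.apply_symm_apply]

@[simp]
lemma tensorMap_id [Tensored V C] (K : V) (X : C) : tensorMap K (𝟙 X) = 𝟙 (Tensored.obj X K) := by
  apply (tensorEquiv X K _).injective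
  rw [tensorEquiv_apply, tensorEquiv_apply, unit_tensorMap]
  simp

lemma tensorMap_comp [Tensored V C] (K : V) {X X' X'' : C} (f : X ⟶ X') (g : X' ⟶ X'') :
    tensorMap K (f ≫ g) = tensorMap K f ≫ tensorMap K g := by
  apply (tensorEquiv X K _).injective
  rw [tensorEquiv_apply, tensorEquiv_apply, unit_tensorMap, eHomWhiskerLeft_comp,
    ← Category.assoc, unit_tensorMap, Category.assoc, ← eHom_whisker_exchange,
    ← Category.assoc, unit_tensorMap, Category.assoc, eHomWhiskerRight_comp]

@[simp]
lemma cotensorMap_id [Cotensored V C] (K : V) (Y : C) :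
    cotensorMap K (𝟙 Y) = 𝟙 (Cotensored.obj K Y) := by
  apply (cotensorEquiv K _ Y).injective
  rw [cotensorEquiv_apply, cotensorEquiv_apply, counit_cotensorMap]
  simp

lemma cotensorMap_comp [Cotensored V C] (K : V) {Y Y' Y'' : C} (f : Y ⟶ Y') (g : Y' ⟶ Y'') :
    cotensorMap K (f ≫ g) = cotensorMap K f ≫ cotensorMap K g := by
  apply (cotensorEquiv K _ Y'').injective
  rw [cotensorEquiv_apply, cotensorEquiv_apply, counit_cotensorMap, eHomWhiskerRight_comp,
    ← Category.assoc, counit_cotensorMap, Category.assoc, eHom_whisker_exchange,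
    ← Category.assoc, counit_cotensorMap, Category.assoc, eHomWhiskerLeft_comp]

/-- The map `X ⟶ X ⊗ K` induced by a point `t` of `K`. -/
def tensorPoint [Tensored V C] {K : V} (t : 𝟙_ V ⟶ K) (X : C) : X ⟶ Tensored.obj X K :=
  (eHomEquiv V).symm (t ≫ Tensored.unit X K)

/-- The map `Y ^ K ⟶ Y` induced by a point `t` of `K`. -/
def cotensorPoint [Cotensored V C] {K : V} (t : 𝟙_ V ⟶ K) (Y : C) : Cotensored.obj K Y ⟶ Y :=
  (eHomEquiv V).symm (t ≫ Cotensored.counit K Y)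

lemma tensorPoint_naturality [Tensored V C] {K : V} (t : 𝟙_ V ⟶ K) {X X' : C} (f : X ⟶ X') :
    f ≫ tensorPoint t X' = tensorPoint t X ≫ tensorMap K f := by
  apply (eHomEquiv V).injective
  rw [eHomEquiv_comp_right, eHomEquiv_comp_left, tensorPoint, tensorPoint,
    Equiv.apply_symm_apply, Equiv.apply_symm_apply, Category.assoc, Category.assoc,
    unit_tensorMap]

lemma cotensorPoint_naturality [Cotensored V C] {K : V} (t : 𝟙_ V ⟶ K) {Y Y' : C} (g : Y ⟶ Y') :
    cotensorMap K g ≫ cotensorPoint t Y' = cotensorPoint t Y ≫ g := by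
  apply (eHomEquiv V).injective
  rw [eHomEquiv_comp_right, eHomEquiv_comp_left, cotensorPoint, cotensorPoint,
    Equiv.apply_symm_apply, Equiv.apply_symm_apply, Category.assoc, Category.assoc,
    counit_cotensorMap]

/-- The adjunct `X ⊗ K ⟶ Y` of a morphism `X ⟶ Y ^ K`. -/
def adjunct [Tensored V C] [Cotensored V C] {K : V} {X Y : C} (g : X ⟶ Cotensored.obj K Y) :
    Tensored.obj X K ⟶ Y :=
  (tensorEquiv X K Y).symm (cotensorEquiv K X Y g)

lemma unit_adjunct [Tensored V C] [Cotensored V C] {K : V} {X Y : C}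
    (g : X ⟶ Cotensored.obj K Y) :
    Tensored.unit X K ≫ eHomWhiskerLeft V X (adjunct g) =
      Cotensored.counit K Y ≫ eHomWhiskerRight V g Y := by
  rw [← tensorEquiv_apply, adjunct, Equiv.apply_symm_apply, cotensorEquiv_apply]

lemma tensorPoint_adjunct [Tensored V C] [Cotensored V C] {K : V} (t : 𝟙_ V ⟶ K) {X Y : C}
    (g : X ⟶ Cotensored.obj K Y) : tensorPoint t X ≫ adjunct g = g ≫ cotensorPoint t Y := by
  apply (eHomEquiv V).injective
  rw [eHomEquiv_comp_left, eHomEquiv_comp_right, tensorPoint, cotensorPoint,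
    Equiv.apply_symm_apply, Equiv.apply_symm_apply, Category.assoc, Category.assoc, unit_adjunct]

lemma adjunct_naturality [Tensored V C] [Cotensored V C] {K : V} {X X' Y Y' : C}
    (g : X ⟶ Cotensored.obj K Y) (g' : X' ⟶ Cotensored.obj K Y')
    (a : X ⟶ X') (b : Y ⟶ Y') (h : a ≫ g' = g ≫ cotensorMap K b) :
    tensorMap K a ≫ adjunct g' = adjunct g ≫ b := by
  apply (tensorEquiv X K Y').injective
  rw [tensorEquiv_apply, tensorEquiv_apply, eHomWhiskerLeft_comp, ← Category.assoc,
    unit_tensorMap, Category.assoc, ← eHom_whisker_exchange, ← Category.assoc, unit_adjunct,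
    Category.assoc, ← eHomWhiskerRight_comp, h, eHomWhiskerRight_comp, ← Category.assoc,
    counit_cotensorMap, Category.assoc, eHom_whisker_exchange, ← Category.assoc, ← unit_adjunct,
    Category.assoc, eHomWhiskerLeft_comp]

end Tensors

/-! ## Cole's construction

`I` is an object of `V` (the interval) and `t : 𝟙_ V ⟶ I` is a point of it (the endpoint `0`).
-/

section Cole

variable {V : Type u'} [Category.{v'} V] [CartesianMonoidalCategory V] [MonoidalClosed V]
variable (C : Type u) [Category.{v} C] [EnrichedOrdinaryCategory V C]
variable [Cotensored V C]

section MappingPath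

variable [HasPullbacks C] {I : V} (t : 𝟙_ V ⟶ I)

/-- The mapping path space functor: `N f` is the pullback of `f : X ⟶ Y` and `p₀ : Y ^ I ⟶ Y`. -/
def mappingPath : Arrow C ⥤ C where
  obj f := pullback f.hom (cotensorPoint t f.right)
  map a := pullback.map _ _ _ _ a.left (cotensorMap I a.right) a.right
    a.w.symm (cotensorPoint_naturality t a.right).symm
  map_id f := by apply pullback.hom_ext <;> simp
  map_comp a b := by
    apply pullback.hom_ext
    · refine (pullback.lift_fst _ _ _).trans ?_
      rw [Category.assoc, pullback.map, pullback.map, pullback.lift_fst, pullback.lift_fst_assoc,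
        Category.assoc]
      rfl
    · refine (pullback.lift_snd _ _ _).trans ?_
      rw [Category.assoc, pullback.map, pullback.map, pullback.lift_snd, pullback.lift_snd_assoc,
        Category.assoc, ← cotensorMap_comp]
      rfl

variable {C}

/-- The projection `φ_f : N f ⟶ X`. -/
def mappingPathFst (f : Arrow C) : (mappingPath C t).obj f ⟶ f.left :=
  pullback.fst f.hom (cotensorPoint t f.right)

/-- The projection `χ_f : N f ⟶ Y ^ I`. -/
def mappingPathSnd (f : Arrow C) : (mappingPath C t).obj f ⟶ Cotensored.obj I f.right :=
  pullback.snd f.hom (cotensorPoint t f.right)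

lemma mappingPathFst_naturality {f g : Arrow C} (a : f ⟶ g) :
    (mappingPath C t).map a ≫ mappingPathFst t g = mappingPathFst t f ≫ a.left :=
  pullback.lift_fst _ _ _

lemma mappingPathSnd_naturality {f g : Arrow C} (a : f ⟶ g) :
    (mappingPath C t).map a ≫ mappingPathSnd t g =
      mappingPathSnd t f ≫ cotensorMap I a.right :=
  pullback.lift_snd _ _ _

lemma mappingPath_condition [Tensored V C] (f : Arrow C) :
    mappingPathFst t f ≫ f.hom =
      tensorPoint t ((mappingPath C t).obj f) ≫ adjunct (mappingPathSnd t f) := by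
  rw [tensorPoint_adjunct]
  exact pullback.condition

end MappingPath

variable [Tensored V C] [HasPullbacks C] [HasPushouts C] {I : V} (t : 𝟙_ V ⟶ I)

/-- The functor `f ↦ E f`, where `E f` is the pushout of `φ_f : N f ⟶ X` and
`i₀ : N f ⟶ N f ⊗ I`. -/
def coleE : Arrow C ⥤ C where
  obj f := pushout (mappingPathFst t f) (tensorPoint t ((mappingPath C t).obj f))
  map a := pushout.map _ _ _ _ a.left (tensorMap I ((mappingPath C t).map a))
    ((mappingPath C t).map a) (mappingPathFst_naturality t a).symm
    (tensorPoint_naturality t _).symm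
  map_id f := by apply pushout.hom_ext <;> simp
  map_comp a b := by
    apply pushout.hom_ext
    · refine (pushout.inl_desc _ _ _).trans ?_
      rw [pushout.map, pushout.map, pushout.inl_desc_assoc, Category.assoc, pushout.inl_desc]
      exact Category.assoc _ _ _
    · refine (pushout.inr_desc _ _ _).trans ?_
      rw [pushout.map, pushout.map, pushout.inr_desc_assoc, Category.assoc, pushout.inr_desc,
        Functor.map_comp, tensorMap_comp, Category.assoc]

variable {C}

/-- The left factor `L f : X ⟶ E f`. -/
def coleLeft (f : Arrow C) : f.left ⟶ (coleE C t).obj f :=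
  pushout.inl (mappingPathFst t f) (tensorPoint t ((mappingPath C t).obj f))

/-- The right factor `R f : E f ⟶ Y`, induced by `f : X ⟶ Y` and by the adjunct `N f ⊗ I ⟶ Y`
of `χ_f : N f ⟶ Y ^ I`. -/
def coleRight (f : Arrow C) : (coleE C t).obj f ⟶ f.right :=
  pushout.desc f.hom (adjunct (mappingPathSnd t f)) (mappingPath_condition t f)

lemma coleLeft_coleRight (f : Arrow C) : coleLeft t f ≫ coleRight t f = f.hom :=
  pushout.inl_desc _ _ _

lemma coleLeft_naturality {f g : Arrow C} (a : f ⟶ g) :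
    coleLeft t f ≫ (coleE C t).map a = a.left ≫ coleLeft t g :=
  pushout.inl_desc _ _ _

lemma coleRight_naturality {f g : Arrow C} (a : f ⟶ g) :
    (coleE C t).map a ≫ coleRight t g = coleRight t f ≫ a.right := by
  apply pushout.hom_ext
  · have h := congrArg (· ≫ coleRight t g) (coleLeft_naturality t a)
    simp only [Category.assoc, coleLeft_coleRight] at h
    exact h.trans (a.w.trans (pushout.inl_desc_assoc _ _ _ _).symm)
  · simp only [coleE, coleRight, pushout.inr_desc_assoc, pushout.map, Category.assoc,
      pushout.inr_desc]
    exact adjunct_naturality _ _ _ _ (mappingPathSnd_naturality t a)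

variable (C)

/-- The right functor `R` of the factorization `f = R f ∘ L f`. -/
def coleR : Arrow C ⥤ Arrow C where
  obj f := Arrow.mk (coleRight t f)
  map a := Arrow.homMk ((coleE C t).map a) a.right (coleRight_naturality t a)
  map_id f := by ext <;> simp
  map_comp a b := by ext <;> simp

/-- The point of `R`: its component at `f` is the square `(L f, 𝟙) : f ⟶ R f`. -/
def coleUnit : 𝟭 (Arrow C) ⟶ coleR C t where
  app f := Arrow.homMk (coleLeft t f) (𝟙 f.right)
    ((coleLeft_coleRight t f).trans (Category.comp_id _).symm)
  naturality f g a := by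
    ext
    · exact (coleLeft_naturality t a).symm
    · exact (Category.comp_id _).trans (Category.id_comp _).symm

end Cole

/-! ## Factorization systems and smallness -/

section Smallness

variable {C : Type u} [Category.{v} C]

/-- An orthogonal factorization system: a weak factorization system for which the liftings and
the factorizations are unique (the latter up to a unique isomorphism). -/
structure IsOrthogonalFactorizationSystem (E M : MorphismProperty C) : Prop where
  isWeakFactorizationSystem : E.IsWeakFactorizationSystem M
  lift_unique {A B X Y : C} {e : A ⟶ B} {m : X ⟶ Y} (he : E e) (hm : M m) (l l' : B ⟶ X)
    (h₁ : e ≫ l = e ≫ l') (h₂ : l ≫ m = l' ≫ m) : l = l'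
  factorization_unique {X Y Z Z' : C} {e : X ⟶ Z} {m : Z ⟶ Y} {e' : X ⟶ Z'} {m' : Z' ⟶ Y}
    (he : E e) (hm : M m) (he' : E e') (hm' : M m') (h : e ≫ m = e' ≫ m') :
    ∃! i : Z ≅ Z', e ≫ i.hom = e' ∧ i.hom ≫ m' = m

/-- Every object has, up to isomorphism, only a set of `E`-quotients. -/
def IsWellCopowered (E : MorphismProperty C) : Prop :=
  ∀ X : C, ObjectProperty.EssentiallySmall.{v} (fun Q : Under X => E Q.hom)

/-- The inclusion of the category of arrows with codomain `Y` in the category of all arrows. -/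
def overToArrow (Y : C) : Over Y ⥤ Arrow C where
  obj f := Arrow.mk f.hom
  map a := Arrow.homMk a.left (𝟙 Y) (by simp)

/-- `F` sends to colimits the `α`-indexed `M`-colimits over a fixed codomain: if `(f_β)_{β < α}`
is a sequence of arrows `f_β : X_β ⟶ Y` over `Y` and `f_α : X_α ⟶ Y` is a cocone under it for which
`X_α` is the colimit in `C` of the `X_β`, with all legs `X_β ⟶ X_α` in `M`, then `F f_α` is the
colimit of the `F f_β`. -/
def PreservesMColimits {D : Type u'} [Category.{v'} D] (M : MorphismProperty C)
    (α : Cardinal.{v}) (F : Arrow C ⥤ D) : Prop :=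
  ∀ (Y : C) (f : α.ord.ToType ⥤ Over Y) (c : Cocone f),
    Nonempty (IsColimit ((Over.forget Y).mapCocone c)) → (∀ β, M (c.ι.app β).left) →
      Nonempty (IsColimit ((overToArrow Y ⋙ F).mapCocone c))

/-- The monomorphism hypothesis for the class `M` and the mapping path space functor `N`. -/
def MonomorphismHypothesis (M : MorphismProperty C) (N : Arrow C ⥤ C) : Prop :=
  ∃ α : Cardinal.{v}, α.IsRegular ∧ PreservesMColimits M α N

/-- The smallness condition for an endofunctor `R` of the arrow category which preserves
codomains. -/
def SmallnessCondition (R : Arrow C ⥤ Arrow C) : Prop :=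
  ∃ E M : MorphismProperty C, IsOrthogonalFactorizationSystem E M ∧ IsWellCopowered E ∧
    ∃ α : Cardinal.{v}, α.IsRegular ∧ PreservesMColimits M α R

end Smallness

/-! ## Free monads on pointed endofunctors -/

section FreeMonad

variable {D : Type u} [Category.{v} D]

/-- An algebra for the pointed endofunctor `(T, τ)`. -/
structure PointedAlgebra (T : D ⥤ D) (τ : 𝟭 D ⟶ T) where
  /-- the underlying object -/
  carrier : D
  /-- the structure map -/
  str : T.obj carrier ⟶ carrier
  unit : τ.app carrier ≫ str = 𝟙 carrier

namespace PointedAlgebra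

variable {T : D ⥤ D} {τ : 𝟭 D ⟶ T}

/-- A map of algebras for a pointed endofunctor. -/
@[ext]
structure Hom (A B : PointedAlgebra T τ) where
  /-- the underlying morphism -/
  f : A.carrier ⟶ B.carrier
  comm : T.map f ≫ B.str = A.str ≫ f

instance : Category (PointedAlgebra T τ) where
  Hom := Hom
  id A := ⟨𝟙 _, by simp⟩
  comp a b := ⟨a.f ≫ b.f, by rw [T.map_comp, Category.assoc, b.comm, ← Category.assoc, a.comm,
    Category.assoc]⟩
  id_comp a := Hom.ext (Category.id_comp a.f)
  comp_id a := Hom.ext (Category.comp_id a.f)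
  assoc a b c := Hom.ext (Category.assoc a.f b.f c.f)

variable (T τ) in
/-- The forgetful functor. -/
def forget : PointedAlgebra T τ ⥤ D where
  obj A := A.carrier
  map a := a.f

end PointedAlgebra

/-- An algebraically free monad on `(T, τ)`: a monad together with an isomorphism, over `D`,
of its category of algebras with the category of `(T, τ)`-algebras. -/
structure FreeMonad (T : D ⥤ D) (τ : 𝟭 D ⟶ T) where
  /-- the monad -/
  monad : Monad D
  /-- the isomorphism of categories -/
  toPointed : monad.Algebra ⥤ PointedAlgebra T τ
  /-- its inverse -/
  ofPointed : PointedAlgebra T τ ⥤ monad.Algebra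
  toPointed_ofPointed : toPointed ⋙ ofPointed = 𝟭 _
  ofPointed_toPointed : ofPointed ⋙ toPointed = 𝟭 _
  toPointed_forget : toPointed ⋙ PointedAlgebra.forget T τ = monad.forget

/-- Kelly's transfinite sequence generated by an object `A` and the pointed endofunctor `(T, τ)`,
characterized (up to unique isomorphism) by its construction:

* `X 0 = A`, and `X λ = colim_{β < λ} X β` for `λ` a limit ordinal;
* `x β : T (X β) ⟶ X (β + 1)` is an isomorphism for `β = 0`; for `β + 1` it is the coequalizer of
  `T (X β) ⟶ X (β + 1) ⟶ T (X (β + 1))` (that is `x β` followed by `τ`) and the image under `T` of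
  the map `X β ⟶ X (β + 1)`; for a limit ordinal `λ` it is the coequalizer of the two maps
  `colim_{β < λ} T (X β) ⟶ T (X λ)` of which the first is the canonical comparison, and the
  second is `colim_{β < λ} x β` followed by `τ`;
* the map `X β ⟶ X (β + 1)` is `τ` followed by `x β`. -/
structure FreeAlgebraSequence (T : D ⥤ D) (τ : 𝟭 D ⟶ T) (A : D) where
  /-- the sequence of objects, with its connecting maps -/
  X : Ordinal.{v} ⥤ D
  /-- the maps `T (X β) ⟶ X (β + 1)` -/
  x (β : Ordinal.{v}) : T.obj (X.obj β) ⟶ X.obj (Order.succ β)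
  /-- the sequence starts at `A` -/
  zero : A ≅ X.obj 0
  unit_x (β : Ordinal.{v}) : τ.app (X.obj β) ≫ x β = X.map (homOfLE (Order.le_succ β))
  isIso_x_zero : IsIso (x 0)
  condition_succ (β : Ordinal.{v}) :
    (x β ≫ τ.app (X.obj (Order.succ β))) ≫ x (Order.succ β) =
      T.map (X.map (homOfLE (Order.le_succ β))) ≫ x (Order.succ β)
  isColimit_succ (β : Ordinal.{v}) :
    Nonempty (IsColimit (Cofork.ofπ (x (Order.succ β)) (condition_succ β)))
  isWellOrderContinuous : X.IsWellOrderContinuous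
  /-- for a limit ordinal `l`, a map out of `colim_{β < l} T (X β)` is given by its components -/
  condition_limit (l : Ordinal.{v}) (hl : Order.IsSuccLimit l) (β : Ordinal.{v}) (hβ : β < l) :
    T.map (X.map (homOfLE hβ.le)) ≫ x l =
      (x β ≫ X.map (homOfLE (Order.succ_le_of_lt hβ)) ≫ τ.app (X.obj l)) ≫ x l
  existsUnique_limit (l : Ordinal.{v}) (hl : Order.IsSuccLimit l) {Z : D}
    (h : T.obj (X.obj l) ⟶ Z)
    (w : ∀ (β : Ordinal.{v}) (hβ : β < l), T.map (X.map (homOfLE hβ.le)) ≫ h =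
      (x β ≫ X.map (homOfLE (Order.succ_le_of_lt hβ)) ≫ τ.app (X.obj l)) ≫ h) :
    ∃! k : X.obj (Order.succ l) ⟶ Z, x l ≫ k = h

/-- The sequence converges at `β`: it is stationary from `β` on. -/
def FreeAlgebraSequence.ConvergesAt {T : D ⥤ D} {τ : 𝟭 D ⟶ T} {A : D}
    (S : FreeAlgebraSequence T τ A) (β : Ordinal.{v}) : Prop :=
  ∀ (γ : Ordinal.{v}) (h : β ≤ γ), IsIso (S.X.map (homOfLE h))

/-- The free monad `F` on `(T, τ)` exists constructively: for every object `A` Kelly's transfinite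
sequence exists and converges, at some ordinal `β`, and its value `X β` is the free
algebra `F A`: the unit `A ⟶ F A` is the map `A = X 0 ⟶ X β`, and the `(T, τ)`-algebra structure
of the free algebra `F A` is the composite of `x β : T (X β) ⟶ X (β + 1)` with the inverse
of `X β ⟶ X (β + 1)`. -/
def FreeMonadExistsConstructively (T : D ⥤ D) (τ : 𝟭 D ⟶ T) : Prop :=
  ∃ F : FreeMonad T τ, ∀ A : D, ∃ (S : FreeAlgebraSequence T τ A) (β : Ordinal.{v}),
    S.ConvergesAt β ∧
    ∃ e : S.X.obj β ≅ (F.toPointed.obj (F.monad.free.obj A)).carrier,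
      S.zero.hom ≫ S.X.map (homOfLE (zero_le : 0 ≤ β)) ≫ e.hom =
        F.monad.η.app A ≫
          eqToHom (Functor.congr_obj F.toPointed_forget (F.monad.free.obj A)).symm ∧
      S.x β = T.map e.hom ≫ (F.toPointed.obj (F.monad.free.obj A)).str ≫ e.inv ≫
        S.X.map (homOfLE (Order.le_succ β))

end FreeMonad

/-! ## Spaces -/

section Spaces

variable (P : ObjectProperty TopCat.{w}) (hI : P TopCat.I)

/-- The unit interval, in a full subcategory of the category of topological spaces. -/
def interval : P.FullSubcategory := ⟨TopCat.I, hI⟩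

/-- The endpoint `0` of the unit interval. -/
def intervalZero [CartesianMonoidalCategory P.FullSubcategory] :
    𝟙_ P.FullSubcategory ⟶ interval P hI :=
  ObjectProperty.homMk (TopCat.ofHom (ContinuousMap.const _ (TopCat.I.homeomorph.symm 0)))

end Spaces

end Hurewicz

end

noncomputable section

namespace Hurewicz

/-! ## Transfinite iteration along all ordinals -/

section Iteration

variable {K : Type u} [Category.{v} K]

/-! Part 1. `E f` is a pushout built from `X`, `N f` and `N f ⊗ I`. The colimit at `X` is given, the
one at `N f` is assumed, and `- ⊗ I` preserves colimits because it is left adjoint to the cotensor;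
since colimits commute with pushouts, `E` preserves the colimit (`preservesMColimits_coleE`). For
`R` there remain only the codomains, which form a constant diagram on a nonempty chain
(`preservesMColimits_coleR`). Part 2 then holds with the given factorization system.

Part 3, existence. Write `T` for `R`. Call a map `T A ⟶ B`, i.e. an object of `Comma T (𝟭 D)`, a
stage. Kelly's sequence is a transfinite iteration in the category of stages, whose stage at `β` is
`x β : T (X β) ⟶ X (β + 1)` up to isomorphism; colimits of stages exist and encode the coequalizer
at limit ordinals. A pointed algebra is a stage `T B ⟶ B`, and maps from any stage of the sequence
to it correspond to maps from `A` to `B`. Once `X β ⟶ X (β + 1)` is invertible, stage `β` is itself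
an algebra, hence the free one, and the free algebras assemble into a left adjoint whose monad is
algebraically free.

Part 3, convergence. The maps of the sequence need not lie in `M`, so `R` is not known to preserve
their colimits. Instead `X (b i) ⟶ X l` is factored as an `E`-map to `Z i` followed by an `M`-map.
Well-copoweredness makes the images of a given term stabilize (`exists_image_stable`), so each `Z i`
maps back to some `X (b' i)` with `b' i < l`. For `l` the supremum of a fast enough `α`-sequence,
the `Z i` interleave with the `X β` and have colimit `X l` with legs in `M`. As `R` preserves this
colimit, the sequence is stationary at `l` (`isIso_map_succ_of_interleaving`). Two further facts are
needed: `E` consists of epimorphisms (`epi_of_isWellCopowered`), and all codomains in the sequence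
are isomorphic, so that the `Z i` can be placed over a fixed object. -/

instance essentiallySmall_Iio (o : Ordinal.{w}) : EssentiallySmall.{w} (Set.Iio o) :=
  essentiallySmall_of_small_of_locallySmall _

/-- A functor out of the ordinals which iterates a successor structure. -/
structure IsIteration (Φ : SmallObject.SuccStruct K) (Y : Ordinal.{w} ⥤ K) : Prop where
  continuous : Y.IsWellOrderContinuous
  zero : Nonempty (Y.obj 0 ≅ Φ.X₀)
  succ (β : Ordinal.{w}) : ∃ i : Y.obj (Order.succ β) ≅ Φ.succ (Y.obj β),
    Y.map (homOfLE (Order.le_succ β)) = Φ.toSucc (Y.obj β) ≫ i.inv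

section

variable {L : Type u'} [Category.{v'} L] (J : K ⥤ L)

open Classical in
/-- The extension of a successor structure along a functor. -/
def extendSuccStruct (Φ : SmallObject.SuccStruct K) : SmallObject.SuccStruct L where
  X₀ := J.obj Φ.X₀
  -- Iterates never leave the essential image, so the value elsewhere is irrelevant; the default is
  -- to stay put.
  succ P := if h : J.essImage P then J.obj (Φ.succ h.witness) else P
  toSucc P := if h : J.essImage P then
      h.getIso.inv ≫ J.map (Φ.toSucc h.witness) ≫ eqToHom (by rw [dif_pos h])
    else eqToHom (by rw [dif_neg h])

variable (Φ : SmallObject.SuccStruct K)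

/-- The successor of an object of the essential image. -/
def extendSuccStructSuccIso {P : L} (h : J.essImage P) :
    (extendSuccStruct J Φ).succ P ≅ J.obj (Φ.succ h.witness) :=
  eqToIso (dif_pos h)

lemma extendSuccStruct_toSucc {P : L} (h : J.essImage P) :
    (extendSuccStruct J Φ).toSucc P =
      h.getIso.inv ≫ J.map (Φ.toSucc h.witness) ≫ (extendSuccStructSuccIso J Φ h).inv :=
  dif_pos h

/-- The large category `L` is needed only so that the iteration along all ordinals is available.
Each limit step is a colimit over some `Set.Iio β`, which exists in `K` and is preserved by `J`. -/
lemma essImage_iteration [HasIterationOfShape Ordinal.{w} L] [J.Full] [J.Faithful]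
    [∀ o : Ordinal.{w}, HasColimitsOfShape (Set.Iio o) K]
    [∀ o : Ordinal.{w}, PreservesColimitsOfShape (Set.Iio o) J] (β : Ordinal.{w}) :
    J.essImage (((extendSuccStruct J Φ).iterationFunctor Ordinal.{w}).obj β) := by
  induction β using SuccOrder.limitRecOn with
  | isMin β hβ =>
    obtain rfl := hβ.eq_bot
    exact ⟨Φ.X₀, ⟨((extendSuccStruct J Φ).iterationFunctorObjBotIso _).symm⟩⟩
  | succ β hβ h =>
    exact ⟨_, ⟨(extendSuccStructSuccIso J Φ h).symm ≪≫
      ((extendSuccStruct J Φ).iterationFunctorObjSuccIso β hβ).symm⟩⟩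
  | isSuccLimit β hβ h =>
    let F := (Set.principalSegIio β).monotone.functor ⋙
      (extendSuccStruct J Φ).iterationFunctor Ordinal.{w}
    let G : Set.Iio β ⥤ K := J.essImage.lift F (fun γ => h γ.1 γ.2) ⋙ J.toEssImage.inv
    let e : G ⋙ J ≅ F := NatIso.ofComponents
      (fun γ => J.essImage.ι.mapIso (J.toEssImage.asEquivalence.counitIso.app
        ((J.essImage.lift F (fun γ => h γ.1 γ.2)).obj γ)))
      (fun {γ δ} f => congrArg (fun k => J.essImage.ι.map k)
        (J.toEssImage.asEquivalence.counitIso.hom.naturality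
          ((J.essImage.lift F (fun γ => h γ.1 γ.2)).map f)))
    exact ⟨colimit G, ⟨(isColimitOfPreserves J (colimit.isColimit G)).coconePointsIsoOfNatIso
      (Functor.isColimitOfIsWellOrderContinuous _ β hβ) e⟩⟩

lemma exists_isIteration_of_embedding [HasIterationOfShape Ordinal.{w} L] [J.Full] [J.Faithful]
    [∀ o : Ordinal.{w}, HasColimitsOfShape (Set.Iio o) K]
    [∀ o : Ordinal.{w}, PreservesColimitsOfShape (Set.Iio o) J] :
    ∃ Y : Ordinal.{w} ⥤ K, IsIteration Φ Y := by
  let Ψ := extendSuccStruct J Φ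
  let F := Ψ.iterationFunctor Ordinal.{w}
  have h (β : Ordinal.{w}) : J.essImage (F.obj β) := essImage_iteration J Φ β
  let Y : Ordinal.{w} ⥤ K :=
    { obj β := (h β).witness
      map f := J.preimage ((h _).getIso.hom ≫ F.map f ≫ (h _).getIso.inv)
      map_id β := by apply J.map_injective; simp
      map_comp f g := by
        apply J.map_injective
        simp only [Functor.map_preimage, Functor.map_comp, Category.assoc, F]
        congr 2
        exact ((h _).getIso.inv_hom_id_assoc _).symm }
  let e : Y ⋙ J ≅ F := NatIso.ofComponents (fun β => (h β).getIso) (fun f => by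
    simp only [Functor.comp_map, Y, Functor.map_preimage, Category.assoc]
    congr 1
    exact (congrArg _ (h _).getIso.inv_hom_id).trans (Category.comp_id _))
  refine ⟨Y, ⟨⟨fun l hl => ?_⟩, ?_, fun β => ?_⟩⟩
  · have := Functor.isWellOrderContinuous_of_iso e.symm
    exact ⟨isColimitOfReflects J ((Y ⋙ J).isColimitOfIsWellOrderContinuous l hl)⟩
  · exact ⟨J.preimageIso ((h 0).getIso ≪≫ Ψ.iterationFunctorObjBotIso _)⟩
  · let i : F.obj (Order.succ β) ≅ J.obj (Φ.succ (Y.obj β)) :=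
      Ψ.iterationFunctorObjSuccIso β (not_isMax β) ≪≫ extendSuccStructSuccIso J Φ (h β)
    refine ⟨J.preimageIso ((h _).getIso ≪≫ i), ?_⟩
    apply J.map_injective
    simp only [Y, Functor.map_preimage, Functor.map_comp, Functor.preimageIso_inv, F,
      SmallObject.SuccStruct.iterationFunctor_map_succ Ψ β (not_isMax β)]
    rw [extendSuccStruct_toSucc J Φ (h β)]
    simp [i]

end

/-- A successor structure can be iterated along all the ordinals of the universe, even though the
category need only have small colimits. -/
theorem exists_isIteration [HasColimitsOfSize.{w, w} K] (Φ : SmallObject.SuccStruct K) :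
    ∃ Y : Ordinal.{w} ⥤ K, IsIteration Φ Y := by
  have (o : Ordinal.{w}) : HasColimitsOfShape (Set.Iio o) K :=
    hasColimitsOfShape_of_essentiallySmall.{w} _ _
  -- The co-Yoneda embedding `x ↦ Hom(x, -)`: it is full, faithful and preserves colimits, and its
  -- target also has colimits indexed by the large poset of all ordinals.
  let J : K ⥤ (Kᵒᵖᵒᵖ ⥤ Type (max (w + 1) v))ᵒᵖ := (uliftYoneda.{w + 1} (C := Kᵒᵖ)).rightOp
  have : HasColimitsOfSize.{w + 1, w + 1} (Kᵒᵖᵒᵖ ⥤ Type (max (w + 1) v))ᵒᵖ := by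
    have : HasLimitsOfSize.{w + 1, w + 1} (Kᵒᵖᵒᵖ ⥤ Type (max (w + 1) v)) := inferInstance
    infer_instance
  have (o : Ordinal.{w}) : PreservesColimitsOfShape (Set.Iio o) J := by
    have := preservesColimitsOfSize_rightOp.{w + 1, w + 1} (uliftYoneda.{w + 1} (C := Kᵒᵖ))
    infer_instance
  exact exists_isIteration_of_embedding J Φ

end Iteration

/-! ## Kelly's transfinite sequence -/

section KellySequence

variable {D : Type u} [Category.{v} D] {T : D ⥤ D}

/-! ### Colimits in the category of stages `T A ⟶ B`. -/

section StageColimits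

variable {J : Type u'} [Category.{v'} J] [HasColimitsOfShape J D]
  (F : J ⥤ Comma T (𝟭 D))

/-- The comparison `colim T (A j) ⟶ T (colim A j)` for a diagram of stages `T (A j) ⟶ B j`. -/
def stageColimitComparison :
    colimit (F ⋙ Comma.fst T (𝟭 D) ⋙ T) ⟶ T.obj (colimit (F ⋙ Comma.fst T (𝟭 D))) :=
  colimit.desc (F ⋙ Comma.fst T (𝟭 D) ⋙ T) (T.mapCocone (colimit.cocone (F ⋙ Comma.fst T (𝟭 D))))

/-- The map `colim T (A j) ⟶ colim B j` induced by a diagram of stages `T (A j) ⟶ B j`. -/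
def stageColimitMap :
    colimit (F ⋙ Comma.fst T (𝟭 D) ⋙ T) ⟶ colimit (F ⋙ Comma.snd T (𝟭 D)) :=
  colim.map (Functor.whiskerLeft F (Comma.natTrans T (𝟭 D)))

lemma ι_stageColimitComparison (j : J) :
    colimit.ι (F ⋙ Comma.fst T (𝟭 D) ⋙ T) j ≫ stageColimitComparison F =
      T.map (colimit.ι (F ⋙ Comma.fst T (𝟭 D)) j) :=
  colimit.ι_desc _ _

lemma ι_stageColimitMap (j : J) :
    colimit.ι (F ⋙ Comma.fst T (𝟭 D) ⋙ T) j ≫ stageColimitMap F =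
      (F.obj j).hom ≫ colimit.ι (F ⋙ Comma.snd T (𝟭 D)) j :=
  ι_colimMap _ _

variable [HasPushouts D]

/-- The colimit cocone of a diagram of stages. -/
def stageCocone : Cocone F where
  pt :=
    { left := colimit (F ⋙ Comma.fst T (𝟭 D))
      right := pushout (stageColimitComparison F) (stageColimitMap F)
      hom := pushout.inl _ _ }
  ι :=
    { app j :=
        { left := colimit.ι (F ⋙ Comma.fst T (𝟭 D)) j
          right := colimit.ι (F ⋙ Comma.snd T (𝟭 D)) j ≫ pushout.inr _ _
          w := by
            have := congrArg (colimit.ι (F ⋙ Comma.fst T (𝟭 D) ⋙ T) j ≫ ·)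
              (pushout.condition (f := stageColimitComparison F) (g := stageColimitMap F))
            simp only [reassoc_of% (ι_stageColimitComparison F j), reassoc_of% (ι_stageColimitMap F j)] at this
            exact this }
      naturality i j f := by
        ext
        · exact (colimit.w (F ⋙ Comma.fst T (𝟭 D)) f).trans (Category.comp_id _).symm
        · have := colimit.w (F ⋙ Comma.snd T (𝟭 D)) f
          exact ((Category.assoc _ _ _).symm.trans (congrArg (· ≫ pushout.inr _ _) this)).trans
            (Category.comp_id _).symm }

/-- The cocone `stageCocone` is a colimit cocone. -/
def isColimitStageCocone : IsColimit (stageCocone F) where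
  desc s :=
    { left := colimit.desc _ ((Comma.fst T (𝟭 D)).mapCocone s)
      right := pushout.desc
        (T.map (colimit.desc _ ((Comma.fst T (𝟭 D)).mapCocone s)) ≫ s.pt.hom)
        (colimit.desc _ ((Comma.snd T (𝟭 D)).mapCocone s)) (by
          apply colimit.hom_ext
          intro j
          rw [reassoc_of% (ι_stageColimitComparison F j), reassoc_of% (ι_stageColimitMap F j), ← T.map_comp_assoc,
            colimit.ι_desc, colimit.ι_desc]
          exact (s.ι.app j).w)
      w := (pushout.inl_desc _ _ _).symm }
  fac s j := by
    ext
    · exact colimit.ι_desc _ _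
    · dsimp [stageCocone]
      rw [Category.assoc, pushout.inr_desc]
      exact colimit.ι_desc _ _
  uniq s m hm := by
    have h₁ : m.left = colimit.desc _ ((Comma.fst T (𝟭 D)).mapCocone s) := by
      apply colimit.hom_ext
      intro j
      rw [colimit.ι_desc]
      exact congrArg CommaMorphism.left (hm j)
    ext
    · exact h₁
    · apply pushout.hom_ext
      · rw [pushout.inl_desc, ← h₁]
        exact m.w.symm
      · rw [pushout.inr_desc]
        apply colimit.hom_ext
        intro j
        rw [colimit.ι_desc]
        exact (Category.assoc _ _ _).symm.trans (congrArg CommaMorphism.right (hm j))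

instance hasColimitsOfShape_stage : HasColimitsOfShape J (Comma T (𝟭 D)) where
  has_colimit F := ⟨⟨⟨_, isColimitStageCocone F⟩⟩⟩

instance preservesColimitsOfShape_fst_stage :
    PreservesColimitsOfShape J (Comma.fst T (𝟭 D)) where
  preservesColimit {F} := preservesColimit_of_preserves_colimit_cocone (isColimitStageCocone F)
    (colimit.isColimit (F ⋙ Comma.fst T (𝟭 D)))

end StageColimits

variable (τ : 𝟭 D ⟶ T)

/-- The map `A ⟶ B` underlying a stage `a : T A ⟶ B`. -/
def stageMap (V : Comma T (𝟭 D)) : V.left ⟶ V.right := τ.app V.left ≫ V.hom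

lemma stageMap_naturality {V W : Comma T (𝟭 D)} (φ : V ⟶ W) :
    φ.left ≫ stageMap τ W = stageMap τ V ≫ φ.right := by
  have h₁ := τ.naturality φ.left
  have h₂ := φ.w
  dsimp at h₁ h₂
  rw [stageMap, stageMap, reassoc_of% h₁, h₂, Category.assoc]

variable [HasCoequalizers D]

/-- The stage `T B ⟶ B'` following the stage `a : T A ⟶ B`. -/
def stageSucc (V : Comma T (𝟭 D)) : Comma T (𝟭 D) where
  left := V.right
  right := coequalizer (V.hom ≫ τ.app V.right) (T.map (stageMap τ V))
  hom := coequalizer.π (V.hom ≫ τ.app V.right) (T.map (stageMap τ V))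

/-- The coequalizer `T B ⟶ B'`. -/
def stageProj (V : Comma T (𝟭 D)) : T.obj V.right ⟶ (stageSucc τ V).right :=
  coequalizer.π (V.hom ≫ τ.app V.right) (T.map (stageMap τ V))

lemma stageProj_condition (V : Comma T (𝟭 D)) :
    V.hom ≫ τ.app V.right ≫ stageProj τ V = T.map (stageMap τ V) ≫ stageProj τ V :=
  (Category.assoc _ _ _).symm.trans (coequalizer.condition _ _)

instance (V : Comma T (𝟭 D)) : Epi (stageProj τ V) :=
  inferInstanceAs (Epi (coequalizer.π (V.hom ≫ τ.app V.right) (T.map (stageMap τ V))))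

lemma exists_stageProj_comp_eq {V : Comma T (𝟭 D)} {Z : D} (h : T.obj V.right ⟶ Z)
    (w : V.hom ≫ τ.app V.right ≫ h = T.map (stageMap τ V) ≫ h) :
    ∃ k : (stageSucc τ V).right ⟶ Z, stageProj τ V ≫ k = h :=
  ⟨coequalizer.desc h ((Category.assoc _ _ _).trans w), coequalizer.π_desc _ _⟩

/-- The map from a stage to the following one. -/
def toStageSucc (V : Comma T (𝟭 D)) : V ⟶ stageSucc τ V where
  left := stageMap τ V
  right := stageMap τ (stageSucc τ V)
  w := (stageProj_condition τ V).symm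

/-- The successor structure on stages which starts with `𝟙 : T A ⟶ T A`. -/
def stageSuccStruct (A : D) : SmallObject.SuccStruct (Comma T (𝟭 D)) where
  X₀ := { left := A, right := T.obj A, hom := 𝟙 _ }
  succ := stageSucc τ
  toSucc := toStageSucc τ

variable {τ}

/-- The isomorphism between a successor stage and the stage following its predecessor. -/
def stageIso {A : D} {Y : Ordinal.{v} ⥤ Comma T (𝟭 D)} (hY : IsIteration (stageSuccStruct τ A) Y)
    (β : Ordinal.{v}) : Y.obj (Order.succ β) ≅ stageSucc τ (Y.obj β) :=
  (hY.succ β).choose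

lemma map_succ_eq {A : D} {Y : Ordinal.{v} ⥤ Comma T (𝟭 D)}
    (hY : IsIteration (stageSuccStruct τ A) Y) (β : Ordinal.{v}) :
    Y.map (homOfLE (Order.le_succ β)) = toStageSucc τ (Y.obj β) ≫ (stageIso hY β).inv :=
  (hY.succ β).choose_spec

section

variable {A : D} {Y : Ordinal.{v} ⥤ Comma T (𝟭 D)} (hY : IsIteration (stageSuccStruct τ A) Y)

/-- The identification of the target of a stage with the source of the following one. -/
def stageShift (β : Ordinal.{v}) : (Y.obj β).right ≅ (Y.obj (Order.succ β)).left :=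
  ((Comma.fst T (𝟭 D)).mapIso (stageIso hY β)).symm

lemma map_succ_left (β : Ordinal.{v}) :
    (Y.map (homOfLE (Order.le_succ β))).left =
      stageMap τ (Y.obj β) ≫ (stageShift hY β).hom :=
  congrArg CommaMorphism.left (map_succ_eq hY β)

/-- The target of stage `β` is the source of stage `β + 1`, so the transition map on targets factors
through the transition map on sources; this is naturality of `stageMap` applied twice. -/
lemma map_right_eq {β γ : Ordinal.{v}} (h : Order.succ β ≤ γ) :
    (Y.map (homOfLE ((Order.le_succ β).trans h))).right =
      (stageShift hY β).hom ≫ (Y.map (homOfLE h)).left ≫ stageMap τ (Y.obj γ) := by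
  have h₁ : Y.map (homOfLE ((Order.le_succ β).trans h)) =
      (toStageSucc τ (Y.obj β) ≫ (stageIso hY β).inv) ≫ Y.map (homOfLE h) := by
    rw [← map_succ_eq, ← Y.map_comp]
    rfl
  have h₂ := congrArg CommaMorphism.right h₁
  dsimp at h₂
  rw [h₂, Category.assoc]
  change stageMap τ _ ≫ _ ≫ _ = (stageIso hY β).inv.left ≫ _
  rw [stageMap_naturality, ← Category.assoc, ← stageMap_naturality, Category.assoc]

/-- The identification of the target of a successor stage. -/
def stageTargetIso (β : Ordinal.{v}) :
    (stageSucc τ (Y.obj β)).right ≅ (Y.obj (Order.succ β)).right :=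
  ((Comma.snd T (𝟭 D)).mapIso (stageIso hY β)).symm

lemma shift_hom (β : Ordinal.{v}) :
    T.map (stageShift hY β).hom ≫ (Y.obj (Order.succ β)).hom =
      stageProj τ (Y.obj β) ≫ (stageTargetIso hY β).hom :=
  (stageIso hY β).inv.w

include hY in
lemma isWellOrderContinuous_left [HasColimits D] :
    (Y ⋙ Comma.fst T (𝟭 D)).IsWellOrderContinuous := by
  have := hY.continuous
  refine ⟨fun l hl => ?_⟩
  have : HasColimitsOfShape (Set.Iio l) D := hasColimitsOfShape_of_essentiallySmall.{v} _ _
  exact ⟨isColimitOfPreserves (Comma.fst T (𝟭 D)) (Y.isColimitOfIsWellOrderContinuous l hl)⟩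

lemma sequence_condition_succ (β : Ordinal.{v}) :
    ((((Y.obj β).hom ≫ (stageShift hY β).hom) ≫ τ.app (Y.obj (Order.succ β)).left) ≫
        (Y.obj (Order.succ β)).hom ≫ (stageShift hY (Order.succ β)).hom) =
      T.map (Y.map (homOfLE (Order.le_succ β))).left ≫
        (Y.obj (Order.succ β)).hom ≫ (stageShift hY (Order.succ β)).hom := by
  have h := τ.naturality (stageShift hY β).hom
  dsimp at h
  simp only [map_succ_left hY, T.map_comp, Category.assoc]
  rw [reassoc_of% h, reassoc_of% (shift_hom hY β), reassoc_of% (stageProj_condition τ (Y.obj β))]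

lemma sequence_existsUnique_succ (β : Ordinal.{v}) {Z : D}
    (h : T.obj (Y.obj (Order.succ β)).left ⟶ Z)
    (w : (((Y.obj β).hom ≫ (stageShift hY β).hom) ≫ τ.app (Y.obj (Order.succ β)).left) ≫ h =
      T.map (Y.map (homOfLE (Order.le_succ β))).left ≫ h) :
    ∃! k : (Y.obj (Order.succ (Order.succ β))).left ⟶ Z,
      ((Y.obj (Order.succ β)).hom ≫ (stageShift hY (Order.succ β)).hom) ≫ k = h := by
  have hτ := τ.naturality (stageShift hY β).hom
  dsimp at hτ
  have hk : (Y.obj β).hom ≫ τ.app (Y.obj β).right ≫ T.map (stageShift hY β).hom ≫ h =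
      T.map (stageMap τ (Y.obj β)) ≫ T.map (stageShift hY β).hom ≫ h := by
    rw [← T.map_comp_assoc, ← map_succ_left hY, ← w, ← reassoc_of% hτ, Category.assoc,
      Category.assoc]
  obtain ⟨k, hk⟩ := exists_stageProj_comp_eq τ _ hk
  refine ⟨(stageShift hY (Order.succ β)).inv ≫ (stageTargetIso hY β).inv ≫ k, ?_, fun m hm => ?_⟩
  · dsimp only
    rw [← cancel_epi (T.map (stageShift hY β).hom), Category.assoc,
      Iso.hom_inv_id_assoc, reassoc_of% (shift_hom hY β), Iso.hom_inv_id_assoc, hk]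
  · rw [Iso.eq_inv_comp, Iso.eq_inv_comp, ← cancel_epi (stageProj τ (Y.obj β)),
      hk, ← reassoc_of% (shift_hom hY β), ← hm, Category.assoc]

lemma sequence_condition_limit {l β : Ordinal.{v}} (h : Order.succ β ≤ l) :
    T.map (Y.map (homOfLE ((Order.le_succ β).trans h))).left ≫
        (Y.obj l).hom =
      (((Y.obj β).hom ≫ (stageShift hY β).hom) ≫ (Y.map (homOfLE h)).left ≫
        τ.app (Y.obj l).left) ≫ (Y.obj l).hom := by
  have hw := (Y.map (homOfLE ((Order.le_succ β).trans h))).w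
  dsimp at hw
  rw [hw, map_right_eq hY h, stageMap]
  simp only [Category.assoc]

/-- A map `h` satisfying the relations makes `T (X l) ⟶ Z` a stage `W` under all stages below `l`.
The stage at `l` is their colimit, so it maps to `W`; this map is the identity on sources, and its
target component is the required factorization. -/
lemma sequence_existsUnique_limit [HasColimits D] (l : Ordinal.{v}) (hl : Order.IsSuccLimit l)
    {Z : D} (h : T.obj (Y.obj l).left ⟶ Z)
    (w : ∀ (β : Ordinal.{v}) (hβ : β < l), T.map (Y.map (homOfLE hβ.le)).left ≫ h =
      (((Y.obj β).hom ≫ (stageShift hY β).hom) ≫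
        (Y.map (homOfLE (Order.succ_le_of_lt hβ))).left ≫ τ.app (Y.obj l).left) ≫ h) :
    ∃! k : (Y.obj l).right ⟶ Z, (Y.obj l).hom ≫ k = h := by
  have hlim := hY.continuous
  have hlim' := isWellOrderContinuous_left hY
  let W : Comma T (𝟭 D) := { left := (Y.obj l).left, right := Z, hom := h }
  let q (β : Ordinal.{v}) (hβ : β < l) : (Y.obj β).right ⟶ Z :=
    (stageShift hY β).hom ≫ (Y.map (homOfLE (Order.succ_le_of_lt hβ))).left ≫ stageMap τ W
  let φ (β : Ordinal.{v}) (hβ : β < l) : Y.obj β ⟶ W :=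
    { left := (Y.map (homOfLE hβ.le)).left
      right := q β hβ
      w := by
        dsimp only [q, stageMap, W]
        rw [w β hβ]
        simp }
  -- On targets the cocone is compatible because, for `β < γ`, everything factors through the source
  -- of stage `β + 1`.
  have hq {β γ : Ordinal.{v}} (hγ : γ < l) (hβγ : β ≤ γ) :
      (Y.map (homOfLE hβγ)).right ≫ q γ hγ = q β (hβγ.trans_lt hγ) := by
    obtain rfl | hlt := hβγ.eq_or_lt
    · have : Y.map (homOfLE hβγ) = 𝟙 _ := Y.map_id β
      rw [this]
      exact Category.id_comp _
    · have hs := Order.succ_le_of_lt hlt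
      have h₁ := map_right_eq hY hs
      have h₂ : Y.map (homOfLE (Order.succ_le_of_lt (hβγ.trans_lt hγ))) =
          Y.map (homOfLE hs) ≫ Y.map (homOfLE (Order.le_succ γ)) ≫
            Y.map (homOfLE (Order.succ_le_of_lt hγ)) := by
        rw [← Y.map_comp, ← Y.map_comp]
        rfl
      dsimp only [q]
      rw [h₂, h₁, Comma.comp_left, Comma.comp_left, map_succ_left hY]
      simp only [Category.assoc]
  let c : Cocone ((Set.principalSegIio l).monotone.functor ⋙ Y) :=
    { pt := W
      ι :=
        { app β := φ β.1 β.2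
          naturality β γ f := by
            ext
            · exact (((Y ⋙ Comma.fst T (𝟭 D)).map_comp (homOfLE (leOfHom f))
                (homOfLE γ.2.le)).symm).trans (Category.comp_id _).symm
            · exact (hq γ.2 (leOfHom f)).trans (Category.comp_id _).symm } }
  let Φ : Y.obj l ⟶ W := (Y.isColimitOfIsWellOrderContinuous l hl).desc c
  have hΦ (β : Ordinal.{v}) (hβ : β < l) : Y.map (homOfLE hβ.le) ≫ Φ = φ β hβ :=
    (Y.isColimitOfIsWellOrderContinuous l hl).fac c ⟨β, hβ⟩
  have hleft : Φ.left = 𝟙 (Y.obj l).left := by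
    apply ((Y ⋙ Comma.fst T (𝟭 D)).isColimitOfIsWellOrderContinuous l hl).hom_ext
    intro β
    exact (congrArg CommaMorphism.left (hΦ β.1 β.2)).trans (Category.comp_id _).symm
  refine ⟨Φ.right, ?_, fun k hk => ?_⟩
  · have h₁ : T.map Φ.left ≫ h = (Y.obj l).hom ≫ Φ.right := Φ.w
    have h₂ := congrArg T.map hleft
    rw [T.map_id] at h₂
    exact h₁.symm.trans ((congrArg (· ≫ h) h₂).trans (Category.id_comp h))
  -- Another factorization `k` also gives a map of stages, so uniqueness comes from the colimit
  -- property.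
  · let Ψ : Y.obj l ⟶ W :=
      { left := 𝟙 _
        right := k
        w := by dsimp [W]; rw [hk, T.map_id, Category.id_comp] }
    suffices Ψ = Φ from congrArg CommaMorphism.right this
    apply (Y.isColimitOfIsWellOrderContinuous l hl).hom_ext
    rintro ⟨β, hβ⟩
    refine Eq.trans ?_ (hΦ β hβ).symm
    ext
    · exact Category.comp_id _
    · change (Y.map (homOfLE hβ.le)).right ≫ k = q β hβ
      rw [map_right_eq hY (Order.succ_le_of_lt hβ)]
      dsimp only [q, stageMap, W]
      simp only [Category.assoc, hk]

/-- Kelly's sequence, from the iteration of the successor structure on stages. -/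
def freeAlgebraSequence [HasColimits D] : FreeAlgebraSequence T τ A where
  X := Y ⋙ Comma.fst T (𝟭 D)
  x β := (Y.obj β).hom ≫ (stageShift hY β).hom
  zero := (Comma.fst T (𝟭 D)).mapIso hY.zero.some.symm
  unit_x β := (Category.assoc _ _ _).symm.trans (map_succ_left hY β).symm
  isIso_x_zero := by
    let i : (Y.obj 0).left ≅ A := (Comma.fst T (𝟭 D)).mapIso hY.zero.some
    let j : (Y.obj 0).right ≅ T.obj A := (Comma.snd T (𝟭 D)).mapIso hY.zero.some
    have h : T.map i.hom ≫ 𝟙 (T.obj A) = (Y.obj 0).hom ≫ j.hom := hY.zero.some.hom.w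
    have h' : (Y.obj 0).hom = T.map i.hom ≫ j.inv := by
      rw [Iso.eq_comp_inv]
      exact h.symm.trans (Category.comp_id _)
    have : IsIso (Y.obj 0).hom := by
      rw [h']
      exact inferInstanceAs (IsIso (T.map i.hom ≫ j.inv))
    exact IsIso.comp_isIso
  condition_succ := sequence_condition_succ hY
  isColimit_succ β := ⟨Cofork.IsColimit.mk _
    (fun s => (sequence_existsUnique_succ hY β s.π s.condition).choose)
    (fun s => (sequence_existsUnique_succ hY β s.π s.condition).choose_spec.1)
    (fun s m hm => (sequence_existsUnique_succ hY β s.π s.condition).choose_spec.2 m hm)⟩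
  isWellOrderContinuous := isWellOrderContinuous_left hY
  condition_limit l hl β hβ := by
    have := congrArg (· ≫ (stageShift hY l).hom)
      (sequence_condition_limit hY (Order.succ_le_of_lt hβ))
    simp only [Category.assoc] at this ⊢
    exact this
  existsUnique_limit l hl Z h w := by
    obtain ⟨k, hk, hk'⟩ := sequence_existsUnique_limit hY l hl h w
    refine ⟨(stageShift hY l).inv ≫ k, by simpa using hk, fun k' h' => ?_⟩
    rw [Iso.eq_inv_comp]
    apply hk'
    dsimp only at h' ⊢
    rw [← h', Category.assoc]

end

end KellySequence

/-! ## The free monad of a left adjoint -/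

section FreeMonadOfAdjunction

variable {D : Type u} [Category.{v} D] {T : D ⥤ D} {τ : 𝟭 D ⟶ T}

namespace PointedAlgebra

lemma hom_ext {A B : PointedAlgebra T τ} {g h : A ⟶ B} (w : g.f = h.f) : g = h := Hom.ext w

lemma eq_conj_eqToHom {A A' B B' : PointedAlgebra T τ} (hA : A = A') (hB : B' = B) (g : A ⟶ B)
    (h : A' ⟶ B') (w : g.f ≍ h.f) : g = eqToHom hA ≫ h ≫ eqToHom hB := by
  subst hA hB
  rw [eqToHom_refl, eqToHom_refl, Category.comp_id, Category.id_comp]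
  exact hom_ext (eq_of_heq w)

end PointedAlgebra

lemma algebra_eq_conj_eqToHom {M : Monad D} {A A' B B' : M.Algebra} (hA : A = A') (hB : B' = B)
    (g : A ⟶ B) (h : A' ⟶ B') (w : g.f ≍ h.f) : g = eqToHom hA ≫ h ≫ eqToHom hB := by
  subst hA hB
  rw [eqToHom_refl, eqToHom_refl, Category.comp_id, Category.id_comp]
  exact Monad.Algebra.Hom.ext' _ _ _ _ (eq_of_heq w)

variable {L : D ⥤ PointedAlgebra T τ} (adj : L ⊣ PointedAlgebra.forget T τ)

/-- The unit of an adjunction with the forgetful functor. -/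
def freeUnit (A : D) : A ⟶ (L.obj A).carrier := adj.unit.app A

/-- The structure map of an algebra of the monad of the adjunction. -/
def monadStr (Q : adj.toMonad.Algebra) : (L.obj Q.A).carrier ⟶ Q.A := Q.a

lemma freeUnit_naturality {A B : D} (g : A ⟶ B) :
    g ≫ freeUnit adj B = freeUnit adj A ≫ (L.map g).f :=
  adj.unit.naturality g

lemma freeUnit_monadStr (Q : adj.toMonad.Algebra) : freeUnit adj Q.A ≫ monadStr adj Q = 𝟙 Q.A :=
  Q.unit

/-- The counit of an adjunction with the forgetful functor. -/
def freeCounit (A : PointedAlgebra T τ) : L.obj A.carrier ⟶ A := adj.counit.app A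

lemma freeUnit_counit (A : PointedAlgebra T τ) :
    freeUnit adj A.carrier ≫ (freeCounit adj A).f = 𝟙 A.carrier :=
  adj.right_triangle_components A

lemma free_hom_ext {A : D} {B : PointedAlgebra T τ} {g h : L.obj A ⟶ B}
    (w : freeUnit adj A ≫ g.f = freeUnit adj A ≫ h.f) : g = h :=
  (adj.homEquiv A B).injective w

/-- The counit is a map of algebras and satisfies a triangle identity. This recovers the structure
map of a pointed algebra from its monad algebra, and identifies the structure of a free algebra. -/
lemma map_freeUnit_str_counit (A : PointedAlgebra T τ) :
    T.map (freeUnit adj A.carrier) ≫ (L.obj A.carrier).str ≫ (freeCounit adj A).f = A.str := by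
  rw [← (freeCounit adj A).comm, ← T.map_comp_assoc]
  exact (congrArg (fun k => T.map k ≫ A.str) (freeUnit_counit adj A)).trans (by simp)

lemma monadStr_naturality {Q Q' : adj.toMonad.Algebra} (h : Q ⟶ Q') :
    (L.map h.f).f ≫ monadStr adj Q' = monadStr adj Q ≫ h.f :=
  h.h

lemma monadStr_assoc (Q : adj.toMonad.Algebra) :
    (freeCounit adj (L.obj Q.A)).f ≫ monadStr adj Q =
      (L.map (monadStr adj Q)).f ≫ monadStr adj Q :=
  Q.assoc

/-- The pointed algebra of an algebra of the monad of the adjunction. -/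
def pointedOfMonad (Q : adj.toMonad.Algebra) : PointedAlgebra T τ where
  carrier := Q.A
  str := T.map (freeUnit adj Q.A) ≫ (L.obj Q.A).str ≫ monadStr adj Q
  unit := by
    have h := τ.naturality (freeUnit adj Q.A)
    dsimp at h
    rw [← reassoc_of% h, reassoc_of% (L.obj Q.A).unit, freeUnit_monadStr]

/-- The functor from algebras of the monad to pointed algebras. -/
def monadToPointed : adj.toMonad.Algebra ⥤ PointedAlgebra T τ where
  obj := pointedOfMonad adj
  map {Q Q'} h := ⟨h.f, by
    dsimp only [pointedOfMonad]
    rw [← T.map_comp_assoc, freeUnit_naturality, T.map_comp_assoc,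
      reassoc_of% (L.map h.f).comm, monadStr_naturality]
    simp only [Category.assoc]⟩
  map_id _ := rfl
  map_comp _ _ := rfl

/-- The structure map of an algebra of the monad is a map of pointed algebras. -/
def pointedOfMonadHom (Q : adj.toMonad.Algebra) : L.obj Q.A ⟶ pointedOfMonad adj Q where
  f := monadStr adj Q
  comm := by
    dsimp only [pointedOfMonad]
    rw [← T.map_comp_assoc, freeUnit_naturality, T.map_comp_assoc,
      reassoc_of% (L.map (monadStr adj Q)).comm, ← monadStr_assoc]
    exact (congrArg (· ≫ monadStr adj Q) (map_freeUnit_str_counit adj (L.obj Q.A))).symm.trans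
      (by simp only [Category.assoc])|>.symm

/-- Two algebra maps out of a free algebra that agree on the unit are equal. This is the other half
of the isomorphism of categories: it recovers the monad structure map. -/
lemma counit_pointedOfMonad (Q : adj.toMonad.Algebra) :
    freeCounit adj (pointedOfMonad adj Q) = pointedOfMonadHom adj Q :=
  free_hom_ext adj ((freeUnit_counit adj _).trans (freeUnit_monadStr adj Q).symm)

/-- The monad of an adjunction with the forgetful functor is algebraically free. -/
def FreeMonad.ofAdjunction : FreeMonad T τ where
  monad := adj.toMonad
  toPointed := monadToPointed adj
  ofPointed := Monad.comparison adj
  toPointed_ofPointed := by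
    refine CategoryTheory.Functor.ext (fun Q => ?_) (fun Q Q' h => ?_)
    -- The carriers agree definitionally, so equality of algebras reduces to equality of structure
    -- maps.
    · have h := congrArg PointedAlgebra.Hom.f (counit_pointedOfMonad adj Q)
      obtain ⟨A, a, _, _⟩ := Q
      change Monad.Algebra.mk _ _ _ _ = Monad.Algebra.mk _ _ _ _
      congr
    · exact algebra_eq_conj_eqToHom _ _ _ h HEq.rfl
  ofPointed_toPointed := by
    refine CategoryTheory.Functor.ext (fun A => ?_) (fun A A' h => ?_)
    · have h := map_freeUnit_str_counit adj A
      obtain ⟨A, a, _⟩ := A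
      change PointedAlgebra.mk _ _ _ = PointedAlgebra.mk _ _ _
      congr
    · exact PointedAlgebra.eq_conj_eqToHom _ _ _ h HEq.rfl
  toPointed_forget := rfl

/-- The free monad exists constructively as soon as Kelly's sequences converge to free algebras. -/
theorem freeMonadExistsConstructively_of_free
    (h : ∀ A : D, ∃ (S : FreeAlgebraSequence T τ A) (β : Ordinal.{v}) (B : PointedAlgebra T τ)
      (e : S.X.obj β ≅ B.carrier), S.ConvergesAt β ∧
      S.x β = T.map e.hom ≫ B.str ≫ e.inv ≫ S.X.map (homOfLE (Order.le_succ β)) ∧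
      ∀ (B' : PointedAlgebra T τ) (g : A ⟶ B'.carrier), ∃! k : B ⟶ B',
        (S.zero.hom ≫ S.X.map (homOfLE (zero_le : 0 ≤ β)) ≫ e.hom) ≫ k.f = g) :
    FreeMonadExistsConstructively T τ := by
  choose S β B e hconv hstr huniv using h
  let η (A : D) : A ⟶ (B A).carrier :=
    (S A).zero.hom ≫ (S A).X.map (homOfLE (zero_le : 0 ≤ β A)) ≫ (e A).hom
  let E (A : D) (B' : PointedAlgebra T τ) :
      (B A ⟶ B') ≃ (A ⟶ (PointedAlgebra.forget T τ).obj B') :=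
    Equiv.ofBijective (fun k => η A ≫ k.f) ⟨fun k k' w =>
      (huniv A B' (η A ≫ k'.f)).unique w rfl, fun g => (huniv A B' g).exists⟩
  let adj := Adjunction.adjunctionOfEquivLeft E (fun A B' B'' l k =>
    (Category.assoc (η A) k.f l.f).symm)
  have hη (A : D) : freeUnit adj A = η A := by
    change E A (B A) (𝟙 _) = η A
    exact Category.comp_id (η A)
  refine ⟨FreeMonad.ofAdjunction adj, fun A => ⟨S A, β A, hconv A, e A, ?_, ?_⟩⟩
  · change η A = freeUnit adj A ≫ 𝟙 _
    rw [hη, Category.comp_id]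
  · have h : ((FreeMonad.ofAdjunction adj).toPointed.obj
        ((FreeMonad.ofAdjunction adj).monad.free.obj A)).str = (B A).str :=
      map_freeUnit_str_counit adj (B A)
    refine (hstr A).trans ?_
    rw [h]
    rfl

end FreeMonadOfAdjunction

/-! ## Convergence of Kelly's sequence -/

section Continuous

variable {K : Type u} [Category.{v} K] (F : Ordinal.{w} ⥤ K)

lemma map_homOfLE_comp {β γ δ : Ordinal.{w}} (h : β ≤ γ) (h' : γ ≤ δ) :
    F.map (homOfLE h) ≫ F.map (homOfLE h') = F.map (homOfLE (h.trans h')) :=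
  (F.map_comp _ _).symm

lemma isIso_map_homOfLE_of_eq {β γ : Ordinal.{w}} (h : β = γ) : IsIso (F.map (homOfLE h.le)) := by
  subst h
  exact (F.map_id β).symm ▸ inferInstance

/-- A continuous sequence is stationary from `β` on if its value does not change at the successor
of any ordinal up to which it is stationary. -/
lemma isIso_map_of_succ [F.IsWellOrderContinuous] {β : Ordinal.{w}}
    (hF : ∀ (γ : Ordinal.{w}) (h : β ≤ γ), IsIso (F.map (homOfLE h)) →
      IsIso (F.map (homOfLE (Order.le_succ γ)))) (γ : Ordinal.{w}) (h : β ≤ γ) :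
    IsIso (F.map (homOfLE h)) := by
  induction γ using SuccOrder.limitRecOn with
  | isMin γ hγ => exact isIso_map_homOfLE_of_eq F (h.antisymm (hγ h))
  | succ γ _ ih =>
    obtain rfl | hlt := h.eq_or_lt
    · exact isIso_map_homOfLE_of_eq F rfl
    · have hβγ := Order.le_of_lt_succ hlt
      have := ih hβγ
      have := hF γ hβγ this
      rw [← map_homOfLE_comp F hβγ (Order.le_succ γ)]
      infer_instance
  | isSuccLimit γ hγ ih =>
    obtain rfl | hlt := h.eq_or_lt
    · exact isIso_map_homOfLE_of_eq F rfl
    · have : Nonempty (Set.Iio γ) := ⟨⟨β, hlt⟩⟩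
      -- Below the limit the diagram is constant from `β` on, so its colimit is already attained at
      -- `β`.
      have hc : ((Set.principalSegIio γ).monotone.functor ⋙ F).IsEventuallyConstantFrom
          ⟨β, hlt⟩ := fun δ f => ih δ.1 δ.2 (leOfHom f)
      exact hc.isIso_ι_of_isColimit (F.isColimitOfIsWellOrderContinuous γ hγ)

end Continuous

/-! ### Maps from stages to pointed algebras. -/

section Stage

variable {D : Type u} [Category.{v} D] {T : D ⥤ D} {τ : 𝟭 D ⟶ T}

/-- The stage `T B ⟶ B` of a pointed algebra. -/
def PointedAlgebra.stage (B : PointedAlgebra T τ) : Comma T (𝟭 D) where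
  left := B.carrier
  right := B.carrier
  hom := B.str

/-- The map of sources underlying a map to the stage of a pointed algebra. -/
def stageLeft {V : Comma T (𝟭 D)} {B : PointedAlgebra T τ} (φ : V ⟶ B.stage) :
    V.left ⟶ B.carrier :=
  φ.left

/-- The map of targets underlying a map to the stage of a pointed algebra. -/
def stageRight {V : Comma T (𝟭 D)} {B : PointedAlgebra T τ} (φ : V ⟶ B.stage) :
    V.right ⟶ B.carrier :=
  φ.right

lemma stageMap_comp_right {V : Comma T (𝟭 D)} {B : PointedAlgebra T τ} (φ : V ⟶ B.stage) :
    stageMap τ V ≫ stageRight φ = stageLeft φ :=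
  (stageMap_naturality τ φ).symm.trans
    ((congrArg (φ.left ≫ ·) B.unit).trans (Category.comp_id _))

lemma stage_hom_comp_right {V : Comma T (𝟭 D)} {B : PointedAlgebra T τ} (φ : V ⟶ B.stage) :
    V.hom ≫ stageRight φ = T.map (stageLeft φ) ≫ B.str :=
  φ.w.symm

/-- A map to the stage of a pointed algebra. -/
def toStage {V : Comma T (𝟭 D)} {B : PointedAlgebra T τ} (g : V.left ⟶ B.carrier)
    (h : V.right ⟶ B.carrier) (w : V.hom ≫ h = T.map g ≫ B.str) : V ⟶ B.stage where
  left := g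
  right := h
  w := w.symm

/-- By the unit law of the algebra, the source component is `stageMap` followed by the target
component. -/
lemma toStage_hom_ext {V : Comma T (𝟭 D)} {B : PointedAlgebra T τ} {φ ψ : V ⟶ B.stage}
    (w : stageRight φ = stageRight ψ) : φ = ψ := by
  ext
  · exact (stageMap_comp_right φ).symm.trans ((congrArg _ w).trans (stageMap_comp_right ψ))
  · exact w

variable [HasCoequalizers D]

/-- The source component of the extension must be the target component of `φ`. Its target component
is induced on the coequalizer by `T.map (stageRight φ) ≫ B.str`, which coequalizes the two maps by
the unit law. -/
lemma existsUnique_toStageSucc_comp {V : Comma T (𝟭 D)} {B : PointedAlgebra T τ}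
    (φ : V ⟶ B.stage) : ∃! ψ : stageSucc τ V ⟶ B.stage, toStageSucc τ V ≫ ψ = φ := by
  have hτ := τ.naturality (stageRight φ)
  dsimp at hτ
  have w : V.hom ≫ τ.app V.right ≫ T.map (stageRight φ) ≫ B.str =
      T.map (stageMap τ V) ≫ T.map (stageRight φ) ≫ B.str := by
    rw [← T.map_comp_assoc, stageMap_comp_right, ← stage_hom_comp_right, ← reassoc_of% hτ,
      B.unit, Category.comp_id]
  obtain ⟨k, hk⟩ := exists_stageProj_comp_eq τ _ w
  refine ⟨toStage (V := stageSucc τ V) (stageRight φ) k hk, ?_, fun ψ hψ => ?_⟩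
  · apply toStage_hom_ext
    exact stageMap_comp_right (toStage (V := stageSucc τ V) (stageRight φ) k hk)
  · have h : stageLeft ψ = stageRight φ := by
      rw [← hψ]
      exact (stageMap_comp_right ψ).symm
    apply toStage_hom_ext
    rw [← cancel_epi (stageProj τ V)]
    refine (stage_hom_comp_right ψ).trans ?_
    rw [h]
    exact hk.symm

/-- If `s : A ⟶ B` underlies the stage and is invertible, then `r = T s⁻¹ ≫ V.hom` makes `B` an
algebra. It coequalizes the defining pair, and the induced map is inverse to `B ⟶ B'`. -/
lemma isIso_toStageSucc {V : Comma T (𝟭 D)} (h : IsIso (stageMap τ V)) :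
    IsIso (toStageSucc τ V) := by
  have hτ := τ.naturality (inv (stageMap τ V))
  dsimp at hτ
  let r : T.obj V.right ⟶ V.right := T.map (inv (stageMap τ V)) ≫ V.hom
  have hr : stageProj τ V = r ≫ τ.app V.right ≫ stageProj τ V := by
    rw [Category.assoc, stageProj_condition, ← T.map_comp_assoc, IsIso.inv_hom_id, T.map_id,
      Category.id_comp]
  have hτr : τ.app V.right ≫ r = 𝟙 _ := by
    rw [← reassoc_of% hτ]
    exact IsIso.inv_hom_id _
  obtain ⟨k, hk⟩ := exists_stageProj_comp_eq τ r (by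
    rw [hτr, ← T.map_comp_assoc, IsIso.hom_inv_id, T.map_id, Category.id_comp]
    exact Category.comp_id _)
  let l : V.left ≅ (stageSucc τ V).left := @asIso _ _ _ _ (stageMap τ V) h
  let r' : V.right ≅ (stageSucc τ V).right :=
    { hom := τ.app V.right ≫ stageProj τ V
      inv := k
      hom_inv_id := (Category.assoc _ _ _).trans ((congrArg (_ ≫ ·) hk).trans hτr)
      inv_hom_id := by
        rw [← cancel_epi (stageProj τ V), reassoc_of% hk, ← hr, Category.comp_id] }
  exact (Comma.isoMk l r' (toStageSucc τ V).w).isIso_hom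

variable {A : D} {Y : Ordinal.{v} ⥤ Comma T (𝟭 D)} (hY : IsIteration (stageSuccStruct τ A) Y)

include hY

lemma existsUnique_map_comp {B : PointedAlgebra T τ} (φ : Y.obj 0 ⟶ B.stage) (β : Ordinal.{v}) :
    ∃! ψ : Y.obj β ⟶ B.stage, Y.map (homOfLE (zero_le : 0 ≤ β)) ≫ ψ = φ := by
  have := hY.continuous
  induction β using SuccOrder.limitRecOn with
  | isMin β hβ =>
    obtain rfl : β = 0 := hβ.eq_bot
    have : Y.map (homOfLE (zero_le : 0 ≤ (0 : Ordinal.{v}))) = 𝟙 _ := Y.map_id _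
    exact ⟨φ, by dsimp only; rw [this, Category.id_comp],
      fun ψ h => by rw [← h, this, Category.id_comp]⟩
  | succ β _ ih =>
    obtain ⟨ψ, hψ, hψ'⟩ := ih
    obtain ⟨χ, hχ, hχ'⟩ := existsUnique_toStageSucc_comp ψ
    have h := map_homOfLE_comp Y (zero_le : 0 ≤ β) (Order.le_succ β)
    refine ⟨(stageIso hY β).hom ≫ χ, ?_, fun m hm => ?_⟩
    · change _ ≫ _ = φ
      rw [← h, map_succ_eq hY, Category.assoc, Category.assoc, Iso.inv_hom_id_assoc, hχ, hψ]
    · rw [← Iso.inv_comp_eq]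
      apply hχ'
      rw [← Category.assoc, ← map_succ_eq hY]
      apply hψ'
      rw [reassoc_of% h, hm]
  | isSuccLimit β hβ ih =>
    let ψ (γ : Ordinal.{v}) (hγ : γ < β) : Y.obj γ ⟶ B.stage := (ih γ hγ).choose
    have hψ (γ : Ordinal.{v}) (hγ : γ < β) : Y.map (homOfLE zero_le) ≫ ψ γ hγ = φ :=
      (ih γ hγ).choose_spec.1
    have hψ' (γ : Ordinal.{v}) (hγ : γ < β) (χ : Y.obj γ ⟶ B.stage)
        (hχ : Y.map (homOfLE zero_le) ≫ χ = φ) : χ = ψ γ hγ := (ih γ hγ).choose_spec.2 χ hχ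
    let c : Cocone ((Set.principalSegIio β).monotone.functor ⋙ Y) :=
      { pt := B.stage
        ι :=
          { app γ := ψ γ.1 γ.2
            naturality γ δ f := by
              refine Eq.trans ?_ (Category.comp_id _).symm
              apply hψ' _ γ.2
              have := map_homOfLE_comp Y (zero_le : 0 ≤ γ.1) (leOfHom f)
              exact ((Category.assoc _ _ _).symm.trans (congrArg (· ≫ ψ δ.1 δ.2) this)).trans
                (hψ _ δ.2) } }
    have hc := Y.isColimitOfIsWellOrderContinuous β hβ
    have hfac (γ : Ordinal.{v}) (hγ : γ < β) : Y.map (homOfLE hγ.le) ≫ hc.desc c = ψ γ hγ :=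
      hc.fac c ⟨γ, hγ⟩
    refine ⟨hc.desc c, ?_, fun m hm => ?_⟩
    · have h0 : 0 < β := hβ.bot_lt
      exact (hfac 0 h0).trans ((hψ' 0 h0 φ (by
        rw [show Y.map (homOfLE (zero_le : 0 ≤ (0 : Ordinal.{v}))) = 𝟙 _ from Y.map_id _,
          Category.id_comp])).symm)
    · apply hc.hom_ext
      rintro ⟨γ, hγ⟩
      refine Eq.trans ?_ (hfac γ hγ).symm
      apply hψ' γ hγ
      have := map_homOfLE_comp Y (zero_le : 0 ≤ γ) hγ.le
      exact ((Category.assoc _ _ _).symm.trans (congrArg (· ≫ m) this)).trans hm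

lemma isIso_map_of_isIso_stageMap {β : Ordinal.{v}} (h : IsIso (stageMap τ (Y.obj β)))
    (γ : Ordinal.{v}) (hγ : β ≤ γ) : IsIso (Y.map (homOfLE hγ)) := by
  have := hY.continuous
  refine isIso_map_of_succ Y (fun δ hδ hiso => ?_) γ hγ
  have h₁ := stageMap_naturality τ (Y.map (homOfLE hδ))
  let i := (Comma.fst T (𝟭 D)).mapIso (asIso (Y.map (homOfLE hδ)))
  let j := (Comma.snd T (𝟭 D)).mapIso (asIso (Y.map (homOfLE hδ)))
  have h₂ : i.hom ≫ stageMap τ (Y.obj δ) = stageMap τ (Y.obj β) ≫ j.hom := h₁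
  have : IsIso (stageMap τ (Y.obj δ)) := by
    have : IsIso (i.hom ≫ stageMap τ (Y.obj δ)) := by
      rw [h₂]
      exact IsIso.comp_isIso
    exact IsIso.of_isIso_comp_left i.hom _
  have := isIso_toStageSucc this
  rw [map_succ_eq hY]
  infer_instance

omit hY in
/-- The pointed algebra of a stage `a : T A ⟶ B` with `A ⟶ B` invertible. -/
def algebraOfStage {V : Comma T (𝟭 D)} (h : IsIso (stageMap τ V)) : PointedAlgebra T τ where
  carrier := V.left
  str := V.hom ≫ inv (stageMap τ V)
  unit := (Category.assoc _ _ _).symm.trans (IsIso.hom_inv_id (stageMap τ V))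

/-- Algebra maps out of `algebraOfStage h` are the same as maps from stage `β` to `B.stage`, hence
by `existsUnique_map_comp` the same as maps from stage `0`. Stage `0` is isomorphic to the identity
of `T A`, so these are determined freely by their source component. -/
lemma existsUnique_hom_algebraOfStage {β : Ordinal.{v}} (h : IsIso (stageMap τ (Y.obj β)))
    (B : PointedAlgebra T τ) (g : (Y.obj 0).left ⟶ B.carrier) :
    ∃! k : algebraOfStage h ⟶ B, (Y.map (homOfLE (zero_le : 0 ≤ β))).left ≫ k.f = g := by
  let i : (Y.obj 0).left ≅ A := (Comma.fst T (𝟭 D)).mapIso hY.zero.some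
  let j : (Y.obj 0).right ≅ T.obj A := (Comma.snd T (𝟭 D)).mapIso hY.zero.some
  have hij : T.map i.hom = (Y.obj 0).hom ≫ j.hom :=
    (Category.comp_id _).symm.trans hY.zero.some.hom.w
  have hj : (Y.obj 0).hom ≫ j.hom ≫ T.map i.inv = 𝟙 _ := by
    have : T.map i.hom ≫ T.map i.inv = 𝟙 _ := by rw [← T.map_comp, i.hom_inv_id, T.map_id]
    rw [hij] at this
    exact (Category.assoc _ _ _).symm.trans this
  have hj' : (j.hom ≫ T.map i.inv) ≫ (Y.obj 0).hom = 𝟙 (Y.obj 0).right := by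
    rw [← cancel_mono j.hom]
    refine (Category.assoc _ _ _).trans ?_
    rw [← hij, Category.assoc, ← T.map_comp, i.inv_hom_id, T.map_id, Category.id_comp]
    exact Category.comp_id _
  have hepi {φ ψ : Y.obj 0 ⟶ B.stage} (hl : φ.left = ψ.left) : φ = ψ := by
    apply toStage_hom_ext
    have h₁ := congrArg ((j.hom ≫ T.map i.inv) ≫ ·) (stage_hom_comp_right φ)
    have h₂ := congrArg ((j.hom ≫ T.map i.inv) ≫ ·) (stage_hom_comp_right ψ)
    have h₃ : (j.hom ≫ T.map i.inv) ≫ (Y.obj 0).hom ≫ stageRight φ =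
        (j.hom ≫ T.map i.inv) ≫ (Y.obj 0).hom ≫ stageRight ψ := by
      rw [h₁, h₂, show stageLeft φ = stageLeft ψ from hl]
    have h₄ (q : (Y.obj 0).right ⟶ B.carrier) :
        (j.hom ≫ T.map i.inv) ≫ (Y.obj 0).hom ≫ q = q :=
      ((Category.assoc _ _ _).symm.trans (congrArg (· ≫ q) hj')).trans (Category.id_comp _)
    exact (h₄ _).symm.trans (h₃.trans (h₄ _))
  let φ : Y.obj 0 ⟶ B.stage := toStage g (j.hom ≫ T.map i.inv ≫ T.map g ≫ B.str) (by
    exact (by simp only [Category.assoc] :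
      (Y.obj 0).hom ≫ j.hom ≫ T.map i.inv ≫ T.map g ≫ B.str =
        ((Y.obj 0).hom ≫ j.hom ≫ T.map i.inv) ≫ T.map g ≫ B.str).trans
        ((congrArg (· ≫ T.map g ≫ B.str) hj).trans (Category.id_comp _)))
  obtain ⟨ψ, hψ, hψ'⟩ := existsUnique_map_comp hY φ β
  refine ⟨⟨ψ.left, ?_⟩, congrArg CommaMorphism.left hψ, fun k hk => ?_⟩
  · refine (stage_hom_comp_right ψ).symm.trans ?_
    change _ = ((Y.obj β).hom ≫ inv (stageMap τ (Y.obj β))) ≫ stageLeft ψ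
    rw [← stageMap_comp_right ψ, Category.assoc, IsIso.inv_hom_id_assoc]
  · let χ : Y.obj β ⟶ B.stage := toStage k.f (inv (stageMap τ (Y.obj β)) ≫ k.f)
      ((Category.assoc _ _ _).symm.trans k.comm.symm)
    have hχ : χ = ψ := hψ' χ (hepi hk)
    apply PointedAlgebra.hom_ext
    exact congrArg CommaMorphism.left hχ

/-- If Kelly's sequence becomes stationary at some stage, it converges there to the free
algebra. -/
lemma exists_free_of_isIso_stageMap [HasColimits D] {β : Ordinal.{v}}
    (h : IsIso (stageMap τ (Y.obj β))) :
    ∃ (S : FreeAlgebraSequence T τ A) (β : Ordinal.{v}) (B : PointedAlgebra T τ)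
      (e : S.X.obj β ≅ B.carrier), S.ConvergesAt β ∧
      S.x β = T.map e.hom ≫ B.str ≫ e.inv ≫ S.X.map (homOfLE (Order.le_succ β)) ∧
      ∀ (B' : PointedAlgebra T τ) (g : A ⟶ B'.carrier), ∃! k : B ⟶ B',
        (S.zero.hom ≫ S.X.map (homOfLE (zero_le : 0 ≤ β)) ≫ e.hom) ≫ k.f = g := by
  refine ⟨freeAlgebraSequence hY, β, algebraOfStage h, Iso.refl _, fun γ hγ => ?_, ?_,
    fun B' g => ?_⟩
  · have := isIso_map_of_isIso_stageMap hY h γ hγ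
    exact inferInstanceAs (IsIso ((Comma.fst T (𝟭 D)).map (Y.map (homOfLE hγ))))
  · have hx : (Y.obj β).hom ≫ (stageShift hY β).hom =
        𝟙 _ ≫ ((Y.obj β).hom ≫ inv (stageMap τ (Y.obj β))) ≫ 𝟙 _ ≫
          (Y.map (homOfLE (Order.le_succ β))).left := by
      rw [map_succ_left hY, Category.id_comp, Category.id_comp, Category.assoc,
        IsIso.inv_hom_id_assoc]
    exact hx.trans (congrArg (· ≫ _) (T.map_id _).symm)
  · let i : A ≅ (Y.obj 0).left := (freeAlgebraSequence hY).zero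
    have hiff (q : (Y.obj β).left ⟶ B'.carrier) :
        (i.hom ≫ (Y.map (homOfLE (zero_le : 0 ≤ β))).left ≫ 𝟙 _) ≫ q = g ↔
        (Y.map (homOfLE (zero_le : 0 ≤ β))).left ≫ q = i.inv ≫ g := by
      rw [Category.comp_id, Category.assoc]
      exact (Iso.eq_inv_comp _).symm
    obtain ⟨k, hk, hk'⟩ := existsUnique_hom_algebraOfStage hY h B' (i.inv ≫ g)
    exact ⟨k, (hiff k.f).2 hk, fun k' h' => hk' k' ((hiff k'.f).1 h')⟩

end Stage

/-- If all of Kelly's sequences become stationary at some ordinal, then the free monad exists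
constructively. -/
theorem freeMonadExistsConstructively_of_isIso {D : Type u} [Category.{v} D] [HasColimits D]
    {T : D ⥤ D} {τ : 𝟭 D ⟶ T}
    (h : ∀ (A : D) (S : FreeAlgebraSequence T τ A), ∃ β : Ordinal.{v},
      IsIso (S.X.map (homOfLE (Order.le_succ β)))) :
    FreeMonadExistsConstructively T τ := by
  refine freeMonadExistsConstructively_of_free fun A => ?_
  have : HasColimits (Comma T (𝟭 D)) := ⟨fun _ _ => inferInstance⟩
  obtain ⟨Y, hY⟩ := exists_isIteration.{v} (stageSuccStruct τ A)
  obtain ⟨β, hβ⟩ := h A (freeAlgebraSequence hY)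
  -- The transition map of the sequence is `stageMap` up to the isomorphism `stageShift`.
  have : IsIso (stageMap τ (Y.obj β)) := by
    have h : IsIso (stageMap τ (Y.obj β) ≫ (stageShift hY β).hom) := by
      rw [← map_succ_left hY]
      exact hβ
    exact IsIso.of_isIso_comp_right _ (stageShift hY β).hom
  exact exists_free_of_isIso_stageMap hY this

/-! ## Preservation of colimits by Cole's construction -/

section ColePreserves

variable {V : Type u'} [Category.{v'} V] [CartesianMonoidalCategory V] [MonoidalClosed V]
variable (C : Type u) [Category.{v} C] [EnrichedOrdinaryCategory V C]
variable [Tensored V C]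

/-- The functor `X ↦ X ⊗ K`. -/
def tensorFunctor (K : V) : C ⥤ C where
  obj X := Tensored.obj X K
  map f := tensorMap K f
  map_id := tensorMap_id K
  map_comp := tensorMap_comp K

variable [Cotensored V C]

/-- The functor `Y ↦ Y ^ K`. -/
def cotensorFunctor (K : V) : C ⥤ C where
  obj Y := Cotensored.obj K Y
  map g := cotensorMap K g
  map_id := cotensorMap_id K
  map_comp := cotensorMap_comp K

/-- Tensors are left adjoint to cotensors. -/
def tensorAdjunction (K : V) : tensorFunctor C K ⊣ cotensorFunctor C K :=
  Adjunction.mkOfHomEquiv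
    { homEquiv X Y := (tensorEquiv X K Y).trans (cotensorEquiv K X Y).symm
      homEquiv_naturality_left_symm {X' X Y} f g :=
        ((adjunct_naturality (K := K) (f ≫ g) g f (𝟙 Y) (by
          rw [cotensorMap_id, Category.comp_id])).trans (Category.comp_id _)).symm
      homEquiv_naturality_right {X Y Y'} f g := by
        let e (Z : C) := (tensorEquiv X K Z).trans (cotensorEquiv K X Z).symm
        apply (e Y').symm.injective
        refine ((e Y').symm_apply_apply _).trans ?_
        have h := adjunct_naturality (K := K) (e Y f) (e Y f ≫ cotensorMap K g) (𝟙 X) g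
          (Category.id_comp _)
        rw [tensorMap_id, Category.id_comp] at h
        exact ((congrArg (· ≫ g) ((e Y).symm_apply_apply f)).symm.trans h.symm) }

instance (K : V) : (tensorFunctor C K).IsLeftAdjoint := (tensorAdjunction C K).isLeftAdjoint

variable [HasPullbacks C] [HasPushouts C] {I : V} (t : 𝟙_ V ⟶ I)

variable {C}

/-- The coprojection `N f ⊗ I ⟶ E f`. -/
def coleCylinder (f : Arrow C) : Tensored.obj ((mappingPath C t).obj f) I ⟶ (coleE C t).obj f :=
  pushout.inr (mappingPathFst t f) (tensorPoint t ((mappingPath C t).obj f))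

lemma coleCylinder_naturality {f g : Arrow C} (a : f ⟶ g) :
    coleCylinder t f ≫ (coleE C t).map a =
      tensorMap I ((mappingPath C t).map a) ≫ coleCylinder t g :=
  pushout.inr_desc _ _ _

lemma cole_condition (f : Arrow C) :
    mappingPathFst t f ≫ coleLeft t f =
      tensorPoint t ((mappingPath C t).obj f) ≫ coleCylinder t f :=
  pushout.condition

lemma coleE_hom_ext {f : Arrow C} {Z : C} {k l : (coleE C t).obj f ⟶ Z}
    (h₁ : coleLeft t f ≫ k = coleLeft t f ≫ l)
    (h₂ : coleCylinder t f ≫ k = coleCylinder t f ≫ l) : k = l :=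
  pushout.hom_ext h₁ h₂

lemma exists_coleE_desc {f : Arrow C} {Z : C} (k : f.left ⟶ Z)
    (l : Tensored.obj ((mappingPath C t).obj f) I ⟶ Z)
    (w : mappingPathFst t f ≫ k = tensorPoint t ((mappingPath C t).obj f) ≫ l) :
    ∃ m : (coleE C t).obj f ⟶ Z, coleLeft t f ≫ m = k ∧ coleCylinder t f ≫ m = l :=
  ⟨pushout.desc k l w, pushout.inl_desc _ _ _, pushout.inr_desc _ _ _⟩

/-- If `N` preserves `α`-indexed `M`-colimits over a fixed codomain, then so does `E`. -/
theorem preservesMColimits_coleE {M : MorphismProperty C} {α : Cardinal.{v}}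
    (h : PreservesMColimits M α (mappingPath C t)) : PreservesMColimits M α (coleE C t) := by
  intro Y f c ⟨hX⟩ hM
  obtain ⟨hN⟩ := h Y f c ⟨hX⟩ hM
  -- `- ⊗ I` is a left adjoint, so no further hypothesis is needed for the third corner of the
  -- pushout.
  have hT := isColimitOfPreserves (tensorFunctor C I) hN
  let A (β : α.ord.ToType) : Arrow C := (overToArrow Y).obj (f.obj β)
  let ι (β : α.ord.ToType) : A β ⟶ (overToArrow Y).obj c.pt := (overToArrow Y).map (c.ι.app β)
  have key (s : Cocone (f ⋙ overToArrow Y ⋙ coleE C t)) :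
      ∃! m : (coleE C t).obj ((overToArrow Y).obj c.pt) ⟶ s.pt,
        ∀ β, (coleE C t).map (ι β) ≫ m = s.ι.app β := by
    let s₁ : Cocone (f ⋙ Over.forget Y) :=
      { pt := s.pt
        ι :=
          { app β := coleLeft t (A β) ≫ s.ι.app β
            naturality β γ a := by
              refine Eq.trans ?_ (Category.comp_id _).symm
              rw [← s.w a]
              exact ((Category.assoc _ _ _).symm.trans (congrArg (· ≫ s.ι.app γ)
                (coleLeft_naturality t ((overToArrow Y).map (f.map a))).symm)).trans
                  (Category.assoc _ _ _) } }
    let s₂ : Cocone ((f ⋙ overToArrow Y ⋙ mappingPath C t) ⋙ tensorFunctor C I) :=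
      { pt := s.pt
        ι :=
          { app β := coleCylinder t (A β) ≫ s.ι.app β
            naturality β γ a := by
              refine Eq.trans ?_ (Category.comp_id _).symm
              rw [← s.w a]
              exact ((Category.assoc _ _ _).symm.trans (congrArg (· ≫ s.ι.app γ)
                (coleCylinder_naturality t ((overToArrow Y).map (f.map a))).symm)).trans
                  (Category.assoc _ _ _) } }
    let k : ((overToArrow Y).obj c.pt).left ⟶ s.pt := hX.desc s₁
    have hk (β) : (ι β).left ≫ k = coleLeft t (A β) ≫ s.ι.app β := hX.fac s₁ β
    let l : Tensored.obj ((mappingPath C t).obj ((overToArrow Y).obj c.pt)) I ⟶ s.pt := hT.desc s₂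
    have hl (β) : tensorMap I ((mappingPath C t).map (ι β)) ≫ l =
        coleCylinder t (A β) ≫ s.ι.app β := hT.fac s₂ β
    -- The two maps induced on the colimits agree on `N f_α` because they agree on each `N f_β`;
    -- this is where the colimit property of `N f_α` itself is used, not only that of its tensor.
    obtain ⟨m, hm, hm'⟩ := exists_coleE_desc t k l (by
      apply hN.hom_ext
      intro β
      change (mappingPath C t).map (ι β) ≫ _ = (mappingPath C t).map (ι β) ≫ _
      rw [← Category.assoc, mappingPathFst_naturality, Category.assoc, hk, ← Category.assoc,
        ← Category.assoc, tensorPoint_naturality, cole_condition, Category.assoc, Category.assoc,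
        hl])
    refine ⟨m, fun β => ?_, fun m' h' => ?_⟩
    · apply coleE_hom_ext
      · rw [← Category.assoc, coleLeft_naturality, Category.assoc, hm, hk]
      · rw [← Category.assoc, coleCylinder_naturality, Category.assoc, hm', hl]
    · apply coleE_hom_ext
      · rw [hm]
        refine hX.hom_ext fun β => ?_
        change (ι β).left ≫ _ = (ι β).left ≫ k
        rw [hk, ← h' β, ← Category.assoc, ← coleLeft_naturality, Category.assoc]
      · rw [hm']
        refine hT.hom_ext fun β => ?_
        change tensorMap I ((mappingPath C t).map (ι β)) ≫ _ =
          tensorMap I ((mappingPath C t).map (ι β)) ≫ l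
        rw [hl, ← h' β, ← Category.assoc, ← coleCylinder_naturality, Category.assoc]
  exact ⟨{ desc s := (key s).choose
           fac s := (key s).choose_spec.1
           uniq s m hm := (key s).choose_spec.2 m hm }⟩

/-- If `E` preserves `α`-indexed `M`-colimits over a fixed codomain, then so does `R`. -/
theorem preservesMColimits_coleR {M : MorphismProperty C} {α : Cardinal.{v}} (hα : α.IsRegular)
    (h : PreservesMColimits M α (coleE C t)) : PreservesMColimits M α (coleR C t) := by
  intro Y f c hX hM
  obtain ⟨hE⟩ := h Y f c hX hM
  -- A colimit of a constant diagram of codomains is that codomain only when the index is nonempty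
  -- and connected.
  have hne : Nonempty α.ord.ToType := by
    rw [Ordinal.nonempty_toType_iff]
    exact fun h => hα.pos.ne' (Cardinal.ord_eq_zero.1 h)
  obtain ⟨β₀⟩ := hne
  let A (β : α.ord.ToType) : Arrow C := (overToArrow Y).obj (f.obj β)
  let ι (β : α.ord.ToType) : A β ⟶ (overToArrow Y).obj c.pt := (overToArrow Y).map (c.ι.app β)
  have key (s : Cocone (f ⋙ overToArrow Y ⋙ coleR C t)) :
      ∃! m : (coleR C t).obj ((overToArrow Y).obj c.pt) ⟶ s.pt,
        ∀ β, (coleR C t).map (ι β) ≫ m = s.ι.app β := by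
    let r (β : α.ord.ToType) : Y ⟶ s.pt.right := (s.ι.app β).right
    have hr' {β γ : α.ord.ToType} (hβγ : β ≤ γ) : r β = r γ :=
      (congrArg CommaMorphism.right (s.w (homOfLE hβγ))).symm.trans (Category.id_comp (r γ))
    have hr (β γ : α.ord.ToType) : r β = r γ := (le_total β γ).elim hr' fun h => (hr' h).symm
    let s' : Cocone (f ⋙ overToArrow Y ⋙ coleE C t) :=
      { pt := s.pt.left
        ι :=
          { app β := (s.ι.app β).left
            naturality β γ a := congrArg CommaMorphism.left (s.ι.naturality a) } }
    let k : (coleE C t).obj ((overToArrow Y).obj c.pt) ⟶ s.pt.left := hE.desc s'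
    have hk (β) : (coleE C t).map (ι β) ≫ k = (s.ι.app β).left := hE.fac s' β
    have hw : k ≫ s.pt.hom = coleRight t ((overToArrow Y).obj c.pt) ≫ r β₀ := by
      refine hE.hom_ext fun β => ?_
      change (coleE C t).map (ι β) ≫ _ = (coleE C t).map (ι β) ≫ _
      have hR : (coleE C t).map (ι β) ≫ coleRight t ((overToArrow Y).obj c.pt) =
          coleRight t (A β) :=
        (coleRight_naturality t (ι β)).trans (Category.comp_id _)
      have hs : ((coleE C t).map (ι β) ≫ k) ≫ s.pt.hom = coleRight t (A β) ≫ r β :=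
        (congrArg (· ≫ s.pt.hom) (hk β)).trans (s.ι.app β).w
      exact ((Category.assoc _ _ _).symm.trans hs).trans
        (((congrArg (coleRight t (A β) ≫ ·) (hr β β₀)).trans
          (congrArg (· ≫ r β₀) hR.symm)).trans (Category.assoc _ _ _))
    refine ⟨Arrow.homMk k (r β₀) hw, fun β => ?_, fun m hm => ?_⟩
    · ext
      · exact hk β
      · exact (Category.id_comp (r β₀)).trans (hr β₀ β)
    · ext
      · refine hE.hom_ext fun β => ?_
        exact (congrArg CommaMorphism.left (hm β)).trans (hk β).symm
      · exact (Category.id_comp m.right).symm.trans (congrArg CommaMorphism.right (hm β₀))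
  exact ⟨{ desc s := (key s).choose
           fac s := (key s).choose_spec.1
           uniq s m hm := (key s).choose_spec.2 m hm }⟩

end ColePreserves

/-! ## Well-copowered factorization systems -/

section Epi

variable {C : Type u} [Category.{v} C] {E M : MorphismProperty C}

lemma IsOrthogonalFactorizationSystem.hasLift (h : IsOrthogonalFactorizationSystem E M)
    {A B X Y : C} {e : A ⟶ B} {m : X ⟶ Y} (he : E e) (hm : M m) {a : A ⟶ X} {b : B ⟶ Y}
    (w : a ≫ m = e ≫ b) : ∃ l : B ⟶ X, e ≫ l = a ∧ l ≫ m = b := by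
  have := h.isWeakFactorizationSystem
  have := MorphismProperty.hasLiftingProperty_of_wfs e m he hm
  let sq : CommSq a e m b := ⟨w⟩
  exact ⟨sq.lift, sq.fac_left, sq.fac_right⟩

/-- `E` is the class of maps with the left lifting property against `M`, and liftings for the
individual copies of `e` glue to one for the wide pushout. -/
lemma widePushout_head_mem [HasColimits C] (h : IsOrthogonalFactorizationSystem E M)
    {A B : C} {e : A ⟶ B} (he : E e) (ι : Type v) :
    E (WidePushout.head (fun _ : ι => e)) := by
  have := h.isWeakFactorizationSystem
  rw [← MorphismProperty.llp_eq_of_wfs E M]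
  refine fun X Y m hm => ⟨fun {a b} sq => ?_⟩
  have hl (i : ι) : ∃ l : B ⟶ X, e ≫ l = a ∧ l ≫ m = WidePushout.ι (fun _ : ι => e) i ≫ b :=
    h.hasLift he hm (by
      rw [sq.w, ← Category.assoc]
      exact congrArg (· ≫ b) (WidePushout.arrow_ι (fun _ : ι => e) i).symm)
  choose l hl hl' using hl
  refine ⟨⟨⟨WidePushout.desc a l hl, ?_, ?_⟩⟩⟩
  · exact WidePushout.head_desc _ a l hl
  · apply WidePushout.hom_ext
    · intro i
      exact (WidePushout.ι_desc_assoc _ a l hl i m).trans (hl' i)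
    · exact (WidePushout.head_desc_assoc _ a l hl m).trans sq.w

/-- The left class of a well-copowered orthogonal factorization system consists of
epimorphisms. -/
theorem epi_of_isWellCopowered [HasColimits C] (h : IsOrthogonalFactorizationSystem E M)
    (hE : IsWellCopowered E) {A B : C} {e : A ⟶ B} (he : E e) : Epi e := by
  by_contra hepi
  obtain ⟨Z, p, q, hpq, hne⟩ : ∃ (Z : C) (p q : B ⟶ Z), e ≫ p = e ≫ q ∧ p ≠ q := by
    by_contra! hc
    exact hepi ⟨fun p q w => hc _ p q w⟩
  obtain ⟨Q, hQ, hQ'⟩ := (hE A).exists_small_le'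
  -- Cantor's argument. Take `κ` large enough to contain every map to `Z` from a representative of
  -- the `E`-quotients of `A`. The wide pushout of `κ` copies of `e` is again such a quotient, yet
  -- choosing `p` or `q` on each copy gives it `2 ^ κ` distinct maps to `Z`.
  let κ : Type v := Σ X : Shrink.{v} (Subtype Q), (((equivShrink _).symm X).1.right ⟶ Z)
  let P : Under A := Under.mk (WidePushout.head (fun _ : κ => e))
  obtain ⟨P', hP', ⟨i⟩⟩ := hQ' P (widePushout_head_mem h he κ)
  classical
  let d (S : Set κ) : P.right ⟶ Z :=
    WidePushout.desc (e ≫ p) (fun k => if k ∈ S then p else q) (fun k => by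
      split_ifs
      · rfl
      · exact hpq.symm)
  have hd : Function.Injective d := fun S S' w => by
    ext k
    have hk := congrArg (WidePushout.ι (fun _ : κ => e) k ≫ ·) w
    simp only [d, WidePushout.ι_desc] at hk
    by_cases h₁ : k ∈ S <;> by_cases h₂ : k ∈ S' <;> simp_all
  let X : Shrink.{v} (Subtype Q) := equivShrink _ ⟨P', hP'⟩
  have hX : ((equivShrink _).symm X).1 = P' := by simp [X]
  let j : P ≅ ((equivShrink _).symm X).1 := i ≪≫ eqToIso hX.symm
  let g (S : Set κ) : κ := ⟨X, j.inv.right ≫ d S⟩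
  have hj : j.hom.right ≫ j.inv.right = 𝟙 P.right :=
    congrArg CommaMorphism.right j.hom_inv_id
  refine Function.cantor_injective g fun S S' w => hd ?_
  have hw : j.inv.right ≫ d S = j.inv.right ≫ d S' := eq_of_heq (Sigma.mk.inj w).2
  have := congrArg (j.hom.right ≫ ·) hw
  simpa only [reassoc_of% hj] using this

end Epi

/-! ## A criterion for convergence -/

section Criterion

variable {D : Type u} [Category.{v} D] {T : D ⥤ D} {τ : 𝟭 D ⟶ T} {A : D}
  (S : FreeAlgebraSequence T τ A)

namespace FreeAlgebraSequence

/-- Naturality of `x` is not part of the definition but follows from the relations imposed at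
successors and limits. -/
lemma map_comp_x {β γ : Ordinal.{v}} (h : β ≤ γ) :
    T.map (S.X.map (homOfLE h)) ≫ S.x γ =
      S.x β ≫ S.X.map (homOfLE (Order.succ_le_succ h)) := by
  induction γ using SuccOrder.limitRecOn with
  | isMin γ hγ =>
    obtain rfl := h.antisymm (hγ h)
    rw [show S.X.map (homOfLE h) = 𝟙 _ from S.X.map_id _, T.map_id, Category.id_comp,
      show S.X.map (homOfLE (Order.succ_le_succ h)) = 𝟙 _ from S.X.map_id _, Category.comp_id]
  | succ γ _ ih =>
    obtain rfl | hlt := h.eq_or_lt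
    · rw [show S.X.map (homOfLE h) = 𝟙 _ from S.X.map_id _, T.map_id, Category.id_comp,
        show S.X.map (homOfLE (Order.succ_le_succ h)) = 𝟙 _ from S.X.map_id _, Category.comp_id]
    · have hβγ := Order.le_of_lt_succ hlt
      have h₁ := map_homOfLE_comp S.X hβγ (Order.le_succ γ)
      have h₂ := map_homOfLE_comp S.X (Order.succ_le_succ hβγ) (Order.le_succ (Order.succ γ))
      rw [← h₁, T.map_comp, Category.assoc, ← S.condition_succ, Category.assoc, S.unit_x,
        reassoc_of% (ih hβγ), h₂]
  | isSuccLimit γ hγ _ =>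
    obtain rfl | hlt := h.eq_or_lt
    · rw [show S.X.map (homOfLE h) = 𝟙 _ from S.X.map_id _, T.map_id, Category.id_comp,
        show S.X.map (homOfLE (Order.succ_le_succ h)) = 𝟙 _ from S.X.map_id _, Category.comp_id]
    · rw [S.condition_limit γ hγ β hlt, Category.assoc, Category.assoc, S.unit_x,
        map_homOfLE_comp]

/-- If `T` preserves the colimit `X l` well enough, the sequence is stationary at `l`. -/
lemma isIso_map_succ_of_limit {l : Ordinal.{v}} (hl : Order.IsSuccLimit l)
    (s : T.obj (S.X.obj l) ⟶ S.X.obj l)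
    (hs : ∀ (β : Ordinal.{v}) (hβ : β < l), T.map (S.X.map (homOfLE hβ.le)) ≫ s =
      S.x β ≫ S.X.map (homOfLE (Order.succ_le_of_lt hβ)))
    (hepi : ∀ {Z : D} (k k' : T.obj (S.X.obj l) ⟶ Z),
      (∀ (β : Ordinal.{v}) (hβ : β < l), T.map (S.X.map (homOfLE hβ.le)) ≫ k =
        T.map (S.X.map (homOfLE hβ.le)) ≫ k') → k = k') :
    IsIso (S.X.map (homOfLE (Order.le_succ l))) := by
  have := S.isWellOrderContinuous
  have hτ {β : Ordinal.{v}} (hβ : β < l) : S.X.map (homOfLE hβ.le) ≫ τ.app (S.X.obj l) =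
      τ.app (S.X.obj β) ≫ T.map (S.X.map (homOfLE hβ.le)) := τ.naturality _
  have hτs : τ.app (S.X.obj l) ≫ s = 𝟙 (S.X.obj l) := by
    apply (S.X.isColimitOfIsWellOrderContinuous l hl).hom_ext
    rintro ⟨β, hβ⟩
    change S.X.map (homOfLE (le_of_lt hβ)) ≫ _ = S.X.map (homOfLE (le_of_lt hβ)) ≫ 𝟙 (S.X.obj l)
    rw [reassoc_of% (hτ hβ), hs β hβ, ← Category.assoc, S.unit_x, map_homOfLE_comp,
      Category.comp_id]
  have w (β : Ordinal.{v}) (hβ : β < l) : T.map (S.X.map (homOfLE hβ.le)) ≫ s =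
      (S.x β ≫ S.X.map (homOfLE (Order.succ_le_of_lt hβ)) ≫ τ.app (S.X.obj l)) ≫ s := by
    rw [hs β hβ, Category.assoc, Category.assoc, hτs, Category.comp_id]
  -- Since `s` satisfies the relations defining `x l`, it factors through `x l`; the factor `k` is
  -- the inverse of `X l ⟶ X (l + 1)`.
  obtain ⟨k, hk, -⟩ := S.existsUnique_limit l hl s w
  refine ⟨k, ?_, ?_⟩
  · rw [← S.unit_x, Category.assoc, hk, hτs]
  · refine (S.existsUnique_limit l hl (S.x l) (fun β hβ => ?_)).unique ?_ (Category.comp_id _)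
    · exact S.condition_limit l hl β hβ
    · apply hepi
      intro β hβ
      rw [reassoc_of% hk, reassoc_of% (hs β hβ), ← S.unit_x]
      refine Eq.trans ?_ (S.condition_limit l hl β hβ).symm
      simp only [Category.assoc]

/-- If `T` preserves a colimit of objects `Z i` which interleave with the sequence below `l`, the
sequence is stationary at `l`. -/
theorem isIso_map_succ_of_interleaving {l : Ordinal.{v}} (hl : Order.IsSuccLimit l)
    {ι : Type w} [Preorder ι] (b b' : ι → Ordinal.{v}) (hb : ∀ i, b i ≤ b' i) (hb' : ∀ i, b' i < l)
    (hmono : Monotone b') (hcof : ∀ β < l, ∃ i, β ≤ b i) (Z : ι → D)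
    (φ : ∀ {i j : ι}, i ≤ j → (Z i ⟶ Z j)) (p : ∀ i, Z i ⟶ S.X.obj l)
    (e : ∀ i, S.X.obj (b i) ⟶ Z i) (d : ∀ i, Z i ⟶ S.X.obj (b' i))
    (hed : ∀ i, e i ≫ d i = S.X.map (homOfLE (hb i)))
    (hdp : ∀ i, d i ≫ S.X.map (homOfLE (hb' i).le) = p i)
    (hφ : ∀ {i j : ι} (h : i ≤ j), φ h ≫ d j = d i ≫ S.X.map (homOfLE (hmono h)))
    (hT : ∀ {W : D} (q : ∀ i, T.obj (Z i) ⟶ W),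
      (∀ {i j : ι} (h : i ≤ j), T.map (φ h) ≫ q j = q i) →
        ∃! k : T.obj (S.X.obj l) ⟶ W, ∀ i, T.map (p i) ≫ k = q i) :
    IsIso (S.X.map (homOfLE (Order.le_succ l))) := by
  -- The candidate algebra structure on `X l`: on `T (Z i)` go to `T (X (b' i))`, apply `x`, and
  -- include into `X l`.
  obtain ⟨s, hs, -⟩ := hT
    (fun i => T.map (d i) ≫ S.x (b' i) ≫ S.X.map (homOfLE (Order.succ_le_of_lt (hb' i))))
    (fun {i j} h => by
      rw [← T.map_comp_assoc, hφ h, T.map_comp_assoc, ← Category.assoc (T.map (S.X.map _)),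
        S.map_comp_x, Category.assoc, map_homOfLE_comp])
  refine S.isIso_map_succ_of_limit hl s (fun β hβ => ?_) (fun {W} k k' hk => ?_)
  · obtain ⟨i, hi⟩ := hcof β hβ
    have h : S.X.map (homOfLE hβ.le) = S.X.map (homOfLE hi) ≫ e i ≫ p i := by
      rw [← hdp i, reassoc_of% (hed i), map_homOfLE_comp, map_homOfLE_comp]
    rw [h, T.map_comp, T.map_comp, Category.assoc, Category.assoc, hs i, ← T.map_comp_assoc,
      ← T.map_comp_assoc, Category.assoc, hed i, map_homOfLE_comp, ← Category.assoc, S.map_comp_x,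
      Category.assoc, map_homOfLE_comp]
  · refine (hT (fun i => T.map (p i) ≫ k') (fun {i j} h => ?_)).unique (fun i => ?_) fun i => rfl
    · rw [← T.map_comp_assoc, ← hdp j, reassoc_of% (hφ h), map_homOfLE_comp, hdp i]
    · rw [← hdp i, T.map_comp, Category.assoc, Category.assoc, hk _ (hb' i)]

end FreeAlgebraSequence

end Criterion

/-! ## Cofinal sequences and stabilization of images -/

section Cofinal

/-- A sequence of ordinals whose growth dominates `g`. -/
def dominatingSeq (g : Ordinal.{v} → Ordinal.{v}) (i : Ordinal.{v}) : Ordinal.{v} :=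
  ⨆ j : Set.Iio i, Order.succ (g (dominatingSeq g j.1))
termination_by i
decreasing_by exact j.2

lemma dominatingSeq_lt (g : Ordinal.{v} → Ordinal.{v}) {j i : Ordinal.{v}} (h : j < i) :
    g (dominatingSeq g j) < dominatingSeq g i := by
  rw [dominatingSeq.eq_1 g i]
  exact (Order.lt_succ _).trans_le
    (Ordinal.le_iSup (fun j : Set.Iio i => Order.succ (g (dominatingSeq g j.1))) ⟨j, h⟩)

lemma exists_le_dominatingSeq (g : Ordinal.{v} → Ordinal.{v}) {β i : Ordinal.{v}}
    (h : β < dominatingSeq g i) : ∃ j < i, β ≤ g (dominatingSeq g j) := by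
  rw [dominatingSeq.eq_1 g i, Ordinal.lt_iSup_iff] at h
  obtain ⟨j, hj⟩ := h
  exact ⟨j.1, j.2, Order.le_of_lt_succ hj⟩

variable {K : Type u} [Category.{v} K] (F : Ordinal.{w} ⥤ K)

/-- The colimit property at a limit ordinal, for a cofinal sequence below it. -/
lemma existsUnique_desc_of_cofinal [F.IsWellOrderContinuous] {l : Ordinal.{w}}
    (hl : Order.IsSuccLimit l) {ι : Type w} [LinearOrder ι] {b : ι → Ordinal.{w}}
    (hmono : Monotone b) (hb : ∀ i, b i < l) (hcof : ∀ β < l, ∃ i, β ≤ b i) {Z : K}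
    (s : ∀ i, F.obj (b i) ⟶ Z)
    (hs : ∀ {i j : ι} (h : i ≤ j), F.map (homOfLE (hmono h)) ≫ s j = s i) :
    ∃! k : F.obj l ⟶ Z, ∀ i, F.map (homOfLE (hb i).le) ≫ k = s i := by
  choose i hi using hcof
  have key {β : Ordinal.{w}} {j j' : ι} (h : β ≤ b j) (h' : β ≤ b j') :
      F.map (homOfLE h) ≫ s j = F.map (homOfLE h') ≫ s j' := by
    wlog hjj : j ≤ j' generalizing j j'
    · exact (this h' h (le_of_not_ge hjj)).symm
    · rw [← hs hjj, ← Category.assoc, map_homOfLE_comp]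
  let c : Cocone ((Set.principalSegIio l).monotone.functor ⋙ F) :=
    { pt := Z
      ι :=
        { app β := F.map (homOfLE (hi β.1 β.2)) ≫ s (i β.1 β.2)
          naturality β γ f := by
            refine Eq.trans ?_ (Category.comp_id _).symm
            have hβγ : β.1 ≤ γ.1 := leOfHom f
            refine Eq.trans ?_ (key (hβγ.trans (hi γ.1 γ.2)) (hi β.1 β.2))
            exact (Category.assoc _ _ _).symm.trans
              (congrArg (· ≫ s _) (map_homOfLE_comp F hβγ (hi γ.1 γ.2))) } }
  have hc := F.isColimitOfIsWellOrderContinuous l hl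
  have hfac (β : Ordinal.{w}) (hβ : β < l) :
      F.map (homOfLE hβ.le) ≫ hc.desc c = F.map (homOfLE (hi β hβ)) ≫ s (i β hβ) :=
    hc.fac c ⟨β, hβ⟩
  refine ⟨hc.desc c, fun j => ?_, fun k hk => ?_⟩
  · rw [hfac _ (hb j), key (hi _ (hb j)) le_rfl,
      show F.map (homOfLE (le_refl (b j))) = 𝟙 _ from F.map_id _, Category.id_comp]
  · apply hc.hom_ext
    rintro ⟨β, hβ⟩
    refine Eq.trans ?_ (hfac β hβ).symm
    rw [← hk, ← Category.assoc, map_homOfLE_comp]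
    rfl

end Cofinal

section Stabilization

variable {C : Type u} [Category.{v} C] [HasColimits C] {E M : MorphismProperty C}

/-- For a sequence of all ordinals, the `(E, M)`-images of `F β` in `F δ` are eventually
constant, so that they map back to some `F γ`. -/
theorem exists_image_stable (h : IsOrthogonalFactorizationSystem E M) (hE : IsWellCopowered E)
    (F : Ordinal.{v} ⥤ C) (β : Ordinal.{v}) :
    ∃ (γ : Ordinal.{v}) (hβγ : β ≤ γ), ∀ (δ : Ordinal.{v}) (hγδ : γ ≤ δ) {Z : C}
      (e : F.obj β ⟶ Z) (m : Z ⟶ F.obj δ), E e → M m →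
      e ≫ m = F.map (homOfLE (hβγ.trans hγδ)) →
      ∃ d : Z ⟶ F.obj γ, e ≫ d = F.map (homOfLE hβγ) ∧ d ≫ F.map (homOfLE hγδ) = m := by
  have := h.isWeakFactorizationSystem
  have hfac (δ : Ordinal.{v}) (hδ : β ≤ δ) : ∃ (Z : C) (e : F.obj β ⟶ Z) (m : Z ⟶ F.obj δ),
      e ≫ m = F.map (homOfLE hδ) ∧ E e ∧ M m := by
    let d := MorphismProperty.factorizationData E M (F.map (homOfLE hδ))
    exact ⟨d.Z, d.i, d.p, d.fac, d.hi, d.hp⟩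
  choose Z e m hem he hm using hfac
  obtain ⟨Q, hQ, hQ'⟩ := (hE (F.obj β)).exists_small_le'
  have hq (δ : Ordinal.{v}) (hδ : β ≤ δ) : ∃ q : Shrink.{v} (Subtype Q),
      Nonempty (Under.mk (e δ hδ) ≅ ((equivShrink _).symm q).1) := by
    obtain ⟨q, hq, ⟨i⟩⟩ := hQ' (Under.mk (e δ hδ)) (he δ hδ)
    exact ⟨equivShrink _ ⟨q, hq⟩, ⟨i ≪≫ eqToIso (by simp)⟩⟩
  choose q i using hq
  -- Pigeonhole: the isomorphism classes of images form a small set, so some class recurs above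
  -- every ordinal; otherwise the supremum of bounds for the classes would give a contradiction.
  obtain ⟨q₀, hq₀⟩ : ∃ q₀, ∀ δ, ∃ (δ' : Ordinal.{v}) (hδ' : β ≤ δ'), δ ≤ δ' ∧ q δ' hδ' = q₀ := by
    by_contra! hcon
    choose f hf using hcon
    let δ := max β (⨆ q, f q)
    have hδ : β ≤ δ := le_max_left _ _
    exact hf (q δ hδ) δ hδ ((Ordinal.le_iSup f _).trans (le_max_right _ _)) rfl
  obtain ⟨γ, hβγ, -, hγ⟩ := hq₀ β
  refine ⟨γ, hβγ, fun δ hγδ {W} e' m' he' hm' hem' => ?_⟩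
  obtain ⟨δ', hβδ', hδδ', hδ'⟩ := hq₀ δ
  -- The image in `F δ` maps to the image in a later `F δ'` of the recurring class, which is
  -- isomorphic to the image in `F γ`.
  obtain ⟨a, ha, -⟩ := h.hasLift he' (hm δ' hβδ') (a := e δ' hβδ')
    (b := m' ≫ F.map (homOfLE hδδ')) (by
      rw [hem, reassoc_of% hem', map_homOfLE_comp])
  have j : Under.mk (e δ' hβδ') ≅ Under.mk (e γ hβγ) :=
    (i δ' hβδ').some ≪≫ eqToIso (by rw [hδ', hγ]) ≪≫ (i γ hβγ).some.symm
  have hj : e δ' hβδ' ≫ j.hom.right = e γ hβγ := Under.w j.hom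
  have hd : e' ≫ a ≫ j.hom.right ≫ m γ hβγ = F.map (homOfLE hβγ) := by
    rw [reassoc_of% ha, reassoc_of% hj, hem]
  refine ⟨a ≫ j.hom.right ≫ m γ hβγ, hd, ?_⟩
  -- The second equation need only be checked after precomposition with the epimorphism `e'`.
  have := epi_of_isWellCopowered h hE he'
  rw [← cancel_epi e', ← Category.assoc, hd, map_homOfLE_comp, hem']

end Stabilization

/-! ## Kelly's sequence for Cole's construction -/

section ArrowId

variable {C : Type u} [Category.{v} C]

lemma arrow_id_hom_ext {P : Arrow C} {W : C} {h k : P ⟶ Arrow.mk (𝟙 W)} (w : h.right = k.right) :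
    h = k := by
  ext
  · have h₁ : h.left ≫ 𝟙 W = P.hom ≫ h.right := h.w
    have h₂ : k.left ≫ 𝟙 W = P.hom ≫ k.right := k.w
    exact (Category.comp_id h.left).symm.trans
      ((h₁.trans (congrArg (P.hom ≫ ·) w)).trans (h₂.symm.trans (Category.comp_id k.left)))
  · exact w

/-- The map to an identity arrow given by a map out of the codomain. -/
def toArrowId {P : Arrow C} {W : C} (r : P.right ⟶ W) : P ⟶ Arrow.mk (𝟙 W) :=
  Arrow.homMk (P.hom ≫ r) r (Category.comp_id _)

/-- Maps `P ⟶ 𝟙 W` are the same as maps `P.right ⟶ W`, so this is the Yoneda argument for codomains.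
-/
lemma isIso_right_of_existsUnique {P Q : Arrow C} (y : P ⟶ Q)
    (hy : ∀ {W : C} (h : P ⟶ Arrow.mk (𝟙 W)), ∃! k : Q ⟶ Arrow.mk (𝟙 W), y ≫ k = h) :
    IsIso y.right := by
  obtain ⟨k, hk, -⟩ := hy (toArrowId (𝟙 P.right))
  have hk' : y.right ≫ k.right = 𝟙 P.right := congrArg CommaMorphism.right hk
  have h : toArrowId (k.right ≫ y.right) = toArrowId (𝟙 Q.right) := by
    refine (hy (toArrowId y.right)).unique (arrow_id_hom_ext ?_) (arrow_id_hom_ext ?_)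
    · change y.right ≫ k.right ≫ y.right = y.right
      rw [← Category.assoc, hk', Category.id_comp]
    · exact Category.comp_id y.right
  exact ⟨k.right, hk', congrArg CommaMorphism.right h⟩

lemma epi_arrow_of_epi_left {P Q : Arrow C} (y : P ⟶ Q) (h₁ : Epi y.left) (h₂ : Epi y.right) :
    Epi y where
  left_cancellation p q w := by
    ext
    · exact (cancel_epi y.left).1 (congrArg CommaMorphism.left w)
    · exact (cancel_epi y.right).1 (congrArg CommaMorphism.right w)

lemma isWellOrderContinuous_comp {K : Type*} [Category K] (F : Ordinal.{v} ⥤ Arrow C)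
    [F.IsWellOrderContinuous] (G : Arrow C ⥤ K)
    [∀ l : Ordinal.{v}, PreservesColimitsOfShape (Set.Iio l) G] :
    (F ⋙ G).IsWellOrderContinuous where
  nonempty_isColimit l hl :=
    ⟨isColimitOfPreserves G (F.isColimitOfIsWellOrderContinuous l hl)⟩

end ArrowId

section ColeSequence

variable {V : Type u'} [Category.{v'} V] [CartesianMonoidalCategory V] [MonoidalClosed V]
variable {C : Type u} [Category.{v} C] [EnrichedOrdinaryCategory V C]
variable [Tensored V C] [Cotensored V C] [HasPullbacks C] [HasColimits C]
variable {I : V} {t : 𝟙_ V ⟶ I} {A : Arrow C}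
variable (S : FreeAlgebraSequence (coleR C t) (coleUnit C t) A)

lemma coleSequence_x_right (β : Ordinal.{v}) :
    (S.x β).right = (S.X.map (homOfLE (Order.le_succ β))).right :=
  (Category.id_comp _).symm.trans (congrArg CommaMorphism.right (S.unit_x β))

/-- Since `R` and its point are trivial on codomains, any map to an identity arrow automatically
satisfies the relations defining `x β`, and hence factors uniquely through it. -/
lemma isIso_coleSequence_x_right (β : Ordinal.{v}) : IsIso (S.x β).right := by
  induction β using SuccOrder.limitRecOn with
  | isMin β hβ =>
    obtain rfl : β = 0 := hβ.eq_bot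
    have := S.isIso_x_zero
    exact inferInstanceAs (IsIso (Arrow.rightFunc.map (S.x 0)))
  | succ β _ _ =>
    apply isIso_right_of_existsUnique
    intro W h
    obtain ⟨hc⟩ := S.isColimit_succ β
    have w : (S.x β ≫ (coleUnit C t).app (S.X.obj (Order.succ β))) ≫ h =
        (coleR C t).map (S.X.map (homOfLE (Order.le_succ β))) ≫ h := by
      apply arrow_id_hom_ext
      exact congrArg (· ≫ h.right) ((Category.comp_id _).trans (coleSequence_x_right S β))
    refine ⟨hc.desc (Cofork.ofπ h w), hc.fac (Cofork.ofπ h w) WalkingParallelPair.one,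
      fun k hk => ?_⟩
    apply Cofork.IsColimit.hom_ext hc
    exact hk.trans (hc.fac (Cofork.ofπ h w) WalkingParallelPair.one).symm
  | isSuccLimit l hl _ =>
    apply isIso_right_of_existsUnique
    intro W h
    apply S.existsUnique_limit l hl
    intro β hβ
    apply arrow_id_hom_ext
    refine congrArg (· ≫ h.right) ?_
    have h₁ := congrArg CommaMorphism.right
      (map_homOfLE_comp S.X (Order.le_succ β) (Order.succ_le_of_lt hβ))
    refine h₁.symm.trans ?_
    refine congrArg₂ (· ≫ ·) (coleSequence_x_right S β).symm (Category.comp_id _).symm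

lemma isIso_coleSequence_map_right {β γ : Ordinal.{v}} (h : β ≤ γ) :
    IsIso (S.X.map (homOfLE h)).right := by
  have := S.isWellOrderContinuous
  have (l : Ordinal.{v}) : HasColimitsOfShape (Set.Iio l) C :=
    hasColimitsOfShape_of_essentiallySmall.{v} _ _
  have : (S.X ⋙ Arrow.rightFunc).IsWellOrderContinuous := isWellOrderContinuous_comp _ _
  refine isIso_map_of_succ (S.X ⋙ Arrow.rightFunc) (fun γ _ _ => ?_) γ h
  change IsIso (S.X.map (homOfLE (Order.le_succ γ))).right
  rw [← coleSequence_x_right]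
  exact isIso_coleSequence_x_right S γ

variable {E M : MorphismProperty C}

/-- Kelly's sequence for Cole's construction becomes stationary. -/
theorem exists_isIso_coleSequence (h : IsOrthogonalFactorizationSystem E M)
    (hE : IsWellCopowered E) {α : Cardinal.{v}} (hα : α.IsRegular)
    (hR : PreservesMColimits M α (coleR C t)) :
    ∃ β : Ordinal.{v}, IsIso (S.X.map (homOfLE (Order.le_succ β))) := by
  have := S.isWellOrderContinuous
  have (l : Ordinal.{v}) : HasColimitsOfShape (Set.Iio l) C :=
    hasColimitsOfShape_of_essentiallySmall.{v} _ _
  have : (S.X ⋙ Arrow.leftFunc).IsWellOrderContinuous := isWellOrderContinuous_comp _ _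
  have := h.isWeakFactorizationSystem
  choose g hg hstable using exists_image_stable h hE (S.X ⋙ Arrow.leftFunc)
  have hlim := Cardinal.isSuccLimit_ord hα.aleph0_le
  have hlt {i j : Ordinal.{v}} (hij : i < j) : dominatingSeq g i < dominatingSeq g j :=
    (hg _).trans_lt (dominatingSeq_lt g hij)
  have hbmono {i j : Ordinal.{v}} (hij : i ≤ j) : dominatingSeq g i ≤ dominatingSeq g j :=
    hij.eq_or_lt.elim (fun h => h ▸ le_rfl) fun h => (hlt h).le
  -- Here `g β` is an index from which the images of `X β` are stable. The choice of `l` gives an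
  -- `α`-indexed cofinal sequence `b` below it with `g (b i) < b j` for `i < j`.
  let l := dominatingSeq g α.ord
  have hcof' {β : Ordinal.{v}} (hβ : β < l) : ∃ j < α.ord, β ≤ dominatingSeq g j := by
    obtain ⟨j, hj, hj'⟩ := exists_le_dominatingSeq g hβ
    exact ⟨_, hlim.succ_lt hj, hj'.trans (dominatingSeq_lt g (Order.lt_succ j)).le⟩
  have hl : Order.IsSuccLimit l := by
    rw [Order.isSuccLimit_iff]
    refine ⟨?_, ?_⟩
    · exact fun hmin => not_le_of_gt (hlt hlim.bot_lt) (hmin (hlt hlim.bot_lt).le)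
    · refine Order.isSuccPrelimit_of_succ_lt fun β hβ => ?_
      obtain ⟨j, hj, hj'⟩ := hcof' hβ
      exact (Order.succ_le_of_lt (hj'.trans_lt (hlt (Order.lt_succ j)))).trans_lt
        (hlt (hlim.succ_lt hj))
  let b (i : α.ord.ToType) : Ordinal.{v} := dominatingSeq g (Ordinal.ToType.toOrd i).1
  have hb (i : α.ord.ToType) : b i < l := hlt (Ordinal.ToType.toOrd i).2
  have hb' (i : α.ord.ToType) : g (b i) < l := dominatingSeq_lt g (Ordinal.ToType.toOrd i).2
  have hmono : Monotone b := fun i j hij => hbmono (Ordinal.ToType.mk.symm.monotone hij)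
  have hmono' : Monotone fun i => g (b i) := fun i j hij => by
    obtain rfl | hlt' := hij.eq_or_lt
    · exact le_rfl
    · exact (dominatingSeq_lt g (Ordinal.ToType.mk.symm.strictMono hlt')).le.trans (hg _)
  have hcof (β : Ordinal.{v}) (hβ : β < l) : ∃ i, β ≤ b i := by
    obtain ⟨j, hj, hj'⟩ := hcof' hβ
    exact ⟨Ordinal.ToType.mk ⟨j, hj⟩, by simpa [b] using hj'⟩
  let F : Ordinal.{v} ⥤ C := S.X ⋙ Arrow.leftFunc
  let fd (i : α.ord.ToType) :=
    MorphismProperty.factorizationData E M (F.map (homOfLE (hb i).le))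
  let Z (i : α.ord.ToType) : C := (fd i).Z
  let e (i : α.ord.ToType) : F.obj (b i) ⟶ Z i := (fd i).i
  let m (i : α.ord.ToType) : Z i ⟶ F.obj l := (fd i).p
  have he (i : α.ord.ToType) : E (e i) := (fd i).hi
  have hm (i : α.ord.ToType) : M (m i) := (fd i).hp
  have hem (i : α.ord.ToType) : e i ≫ m i = F.map (homOfLE (hb i).le) := (fd i).fac
  have hepi (i : α.ord.ToType) : Epi (e i) := epi_of_isWellCopowered h hE (he i)
  have hd (i : α.ord.ToType) := hstable (b i) l (hb' i).le (e i) (m i) (he i) (hm i) (hem i)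
  choose d hed hdm using hd
  -- Orthogonality gives the transition maps between images; their functoriality is checked after
  -- precomposing with the epimorphisms `e i`.
  have hu {i j : α.ord.ToType} (hij : i ≤ j) : ∃ u : Z i ⟶ Z j,
      e i ≫ u = F.map (homOfLE (hmono hij)) ≫ e j ∧ u ≫ m j = m i :=
    h.hasLift (he i) (hm j) (by
      rw [Category.assoc, hem, hem]
      exact map_homOfLE_comp F _ _)
  choose u heu hum using @hu
  let Y : C := (S.X.obj l).right
  -- All images are placed over the codomain of `X l`, since preservation is available only over a
  -- fixed codomain.
  let G : α.ord.ToType ⥤ Over Y :=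
    { obj i := Over.mk (m i ≫ (S.X.obj l).hom)
      map {i j} f := Over.homMk (u (leOfHom f)) (by
        exact (Category.assoc _ _ _).symm.trans (congrArg (· ≫ (S.X.obj l).hom) (hum _)))
      map_id i := by
        ext
        change u _ = 𝟙 (Z i)
        rw [← cancel_epi (e i), heu, show F.map (homOfLE (hmono le_rfl)) = 𝟙 _ from F.map_id _,
          Category.id_comp, Category.comp_id]
      map_comp {i j k} f f' := by
        ext
        change u _ = u _ ≫ u _
        rw [← cancel_epi (e i), heu, ← Category.assoc, heu, Category.assoc, heu,
          ← Category.assoc, map_homOfLE_comp] }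
  let c : Cocone G :=
    { pt := Over.mk (S.X.obj l).hom
      ι :=
        { app i := Over.homMk (m i) rfl
          naturality i j f := by
            ext
            exact (hum _).trans (Category.comp_id (m i)).symm } }
  -- Precomposing with the epimorphisms `e i` turns a cocone on the `Z i` into one on the cofinal
  -- sequence `X (b i)`, so `X l` is also the colimit of the `Z i`.
  have hc (s : Cocone (G ⋙ Over.forget Y)) : ∃! k : F.obj l ⟶ s.pt, ∀ i, m i ≫ k = s.ι.app i := by
    let q (i : α.ord.ToType) : Z i ⟶ s.pt := s.ι.app i
    have hq {i j : α.ord.ToType} (hij : i ≤ j) : u hij ≫ q j = q i := s.w (homOfLE hij)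
    change ∃! k : F.obj l ⟶ s.pt, ∀ i, m i ≫ k = q i
    obtain ⟨k, hk, hk'⟩ := existsUnique_desc_of_cofinal F hl hmono hb hcof
      (fun i => e i ≫ q i) (fun {i j} hij => by
        rw [← hq hij, ← Category.assoc, ← heu hij, Category.assoc])
    refine ⟨k, fun i => ?_, fun k' hk'' => hk' _ fun i => ?_⟩
    · rw [← cancel_epi (e i), ← Category.assoc, hem]
      exact hk i
    · rw [← hem, Category.assoc, hk'']
  obtain ⟨hT⟩ := hR Y G c
    ⟨{ desc s := (hc s).choose
       fac s := (hc s).choose_spec.1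
       uniq s k hk := (hc s).choose_spec.2 k hk }⟩ hm
  have hiso {β γ : Ordinal.{v}} (hβγ : β ≤ γ) := isIso_coleSequence_map_right S hβγ
  let P (i : α.ord.ToType) : Arrow C := (overToArrow Y).obj (G.obj i)
  let φ {i j : α.ord.ToType} (hij : i ≤ j) : P i ⟶ P j := (overToArrow Y).map (G.map (homOfLE hij))
  let p (i : α.ord.ToType) : P i ⟶ S.X.obj l := (overToArrow Y).map (c.ι.app i)
  let e' (i : α.ord.ToType) : S.X.obj (b i) ⟶ P i :=
    Arrow.homMk (e i) (S.X.map (homOfLE (hb i).le)).right (by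
      refine Eq.trans ?_ (S.X.map (homOfLE (hb i).le)).w
      exact (Category.assoc _ _ _).symm.trans (congrArg (· ≫ (S.X.obj l).hom) (hem i)))
  let r (i : α.ord.ToType) : (S.X.obj (g (b i))).right ≅ (S.X.obj l).right :=
    @asIso _ _ _ _ (S.X.map (homOfLE (hb' i).le)).right (hiso (hb' i).le)
  -- Mapping back to `X (g (b i))` on codomains is possible because the codomain maps of the
  -- sequence are invertible.
  let d' (i : α.ord.ToType) : P i ⟶ S.X.obj (g (b i)) :=
    Arrow.homMk (d i) (r i).inv (by
      have hw : (S.X.map (homOfLE (hb' i).le)).left ≫ (S.X.obj l).hom =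
        (S.X.obj (g (b i))).hom ≫ (r i).hom := Arrow.w _
      exact (Iso.eq_comp_inv (r i)).2 ((Category.assoc _ _ _).trans
        ((congrArg (d i ≫ ·) hw.symm).trans ((Category.assoc _ _ _).symm.trans
          (congrArg (· ≫ (S.X.obj l).hom) (hdm i))))))
  have hed' (i : α.ord.ToType) : e' i ≫ d' i = S.X.map (homOfLE (hg (b i))) := by
    ext
    · exact hed i
    · exact (Iso.comp_inv_eq (r i)).2
        (congrArg CommaMorphism.right (map_homOfLE_comp S.X (hg (b i)) (hb' i).le)).symm
  have hdp' (i : α.ord.ToType) : d' i ≫ S.X.map (homOfLE (hb' i).le) = p i := by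
    ext
    · exact hdm i
    · exact (r i).inv_hom_id
  have hep' (i : α.ord.ToType) : e' i ≫ p i = S.X.map (homOfLE (hb i).le) := by
    rw [← hdp', ← Category.assoc, hed', map_homOfLE_comp]
  have heφ {i j : α.ord.ToType} (hij : i ≤ j) :
      e' i ≫ φ hij = S.X.map (homOfLE (hmono hij)) ≫ e' j := by
    ext
    · exact heu hij
    · exact (Category.comp_id _).trans
        (congrArg CommaMorphism.right (map_homOfLE_comp S.X (hmono hij) (hb j).le)).symm
  have hepi' (i : α.ord.ToType) : Epi (e' i) := by
    have : IsIso (e' i).right := hiso (hb i).le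
    exact epi_arrow_of_epi_left _ (hepi i) inferInstance
  refine ⟨l, S.isIso_map_succ_of_interleaving hl b (fun i => g (b i)) (fun i => hg _) hb' hmono'
    hcof P φ p e' d' hed' hdp' (fun {i j} hij => ?_) (fun {W} q hq => ?_)⟩
  · rw [← cancel_epi (e' i), ← Category.assoc, heφ, Category.assoc, hed', map_homOfLE_comp,
      ← Category.assoc, hed', map_homOfLE_comp]
  · let s : Cocone (G ⋙ overToArrow Y ⋙ coleR C t) :=
      { pt := W
        ι :=
          { app i := q i
            naturality i j f := (hq (leOfHom f)).trans (Category.comp_id (q i)).symm } }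
    exact ⟨hT.desc s, hT.fac s, fun k hk => hT.uniq s k hk⟩

end ColeSequence

end Hurewicz

end

theorem mainTheorem6
    (P : ObjectProperty TopCat.{v}) (hI : P TopCat.I)
    [CartesianMonoidalCategory P.FullSubcategory] [MonoidalClosed P.FullSubcategory]
    {C : Type u} [Category.{v} C] [HasLimits C] [HasColimits C]
    [EnrichedOrdinaryCategory P.FullSubcategory C]
    [Hurewicz.Tensored P.FullSubcategory C] [Hurewicz.Cotensored P.FullSubcategory C]
    (E M : MorphismProperty C) (hEM : Hurewicz.IsOrthogonalFactorizationSystem E M)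
    (hE : Hurewicz.IsWellCopowered E)
    (hN : Hurewicz.MonomorphismHypothesis M
      (Hurewicz.mappingPath C (Hurewicz.intervalZero P hI))) :
    (∀ α : Cardinal.{v}, α.IsRegular →
      Hurewicz.PreservesMColimits M α
        (Hurewicz.mappingPath C (Hurewicz.intervalZero P hI)) →
      Hurewicz.PreservesMColimits M α (Hurewicz.coleE C (Hurewicz.intervalZero P hI)) ∧
      Hurewicz.PreservesMColimits M α (Hurewicz.coleR C (Hurewicz.intervalZero P hI))) ∧
    Hurewicz.SmallnessCondition (Hurewicz.coleR C (Hurewicz.intervalZero P hI)) ∧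
    Hurewicz.FreeMonadExistsConstructively (Hurewicz.coleR C (Hurewicz.intervalZero P hI))
      (Hurewicz.coleUnit C (Hurewicz.intervalZero P hI)) := by
  refine ⟨fun α hα h => ⟨Hurewicz.preservesMColimits_coleE _ h,
    Hurewicz.preservesMColimits_coleR _ hα (Hurewicz.preservesMColimits_coleE _ h)⟩, ?_⟩
  obtain ⟨α, hα, h⟩ := hN
  have hR := Hurewicz.preservesMColimits_coleR _ hα (Hurewicz.preservesMColimits_coleE _ h)
  exact ⟨⟨E, M, hEM, hE, α, hα, hR⟩, Hurewicz.freeMonadExistsConstructively_of_isIso fun _ S =>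
    Hurewicz.exists_isIso_coleSequence S hEM hE hα hR⟩
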